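/- Let $t,\lambda_\infty,\nu_\infty\in\mathbb{C}$ and $\hat\lambda_\infty=\lambda_\infty-\nu_\infty\hbar$, where $\hbar$ is a formal parameter. Consider the two quantum curves * (1,4): $\left\{3\hbar^3\frac{d^3}{dx^3}+2t\hbar^2\frac{d^2}{dx^2}+x\hbar\frac{d}{dx}-\hat\lambda_\infty\right\}\psi=0$ with $\lambda_\infty\neq0$; its classical limit $3y^3+2ty^2+xy-\lambda_\infty=0$ is parametrized by $x(z)=-3z^2-2tz+\frac{\lambda_\infty}{z}$, $y(z)=z$; * (2,3): $\left\{4\hbar^3\frac{d^3}{dx^3}-2x\hbar^2\frac{d^2}{dx^2}+2(\hat\lambda_\infty-\hbar)\hbar\frac{d}{dx}-t\right\}\psi=0$ with $t\neq0$; its classical limit $4y^3-2xy^2+2\lambda_\infty y-t=0$ is parametrized by $x(z)=2z+\frac{\lambda_\infty}{z}-\frac{t}{2z^2}$, $y(z)=z$. For an equation $\{p_0\hbar^3\frac{d^3}{dx^3}+p_1\hbar^2\frac{d^2}{dx^2}+p_2\hbar\frac{d}{dx}+p_3\}\psi=0$, the logarithmic derivative $S=\sum_{m\ge-1}\hbar^mS_m$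 of a WKB solution $\psi=\exp\int^xS\,dx$ is a formal solution of $$p_0\hbar^3\left(\frac{d^2S}{dx^2}+3S\frac{dS}{dx}+S^3\right)+p_1\hbar^2\left(\frac{dS}{dx}+S^2\right)+p_2\hbar S+p_3=0 .$$ In the coordinate $z$ (with $x=x(z)$ and $\frac{d}{dx}=\frac{1}{x'(z)}\frac{d}{dz}$) we take the solution with $S_{-1}=y(z)=z$ and with all $S_m$ holomorphic on the set of $z\in\mathbb{C}\setminus\{0\}$ with $x'(z)\ne0$. The zeros of $x'(z)$ are called turning points. Let $\gamma$ be a $C^1$ path on $\mathbb{P}^1$ in the coordinate $z$ from $z=0$ to $z=\infty$ (the two points over the singular point $x=\infty$), whose interior lies in $\mathbb{C}\setminus\{0\}$ and avoids the turning points. The Voros coefficient is the formal power series $$V(\lambda_\infty,t,\nu_\infty;\hbar)=\int_\gamma\left(S-\hbar^{-1}S_{-1}-S_0\right)dx=\sum_{m\ge1}\hbar^m\int_\gamma S_m(z)\,x'(z)\,dz ,$$ the integrals being improper at both ends. Theorem. For both curves such a solution $S$ and such paths $\gamma$ exist, the integrals $\int_\gamma S_m\,dx$ ($m\ge1$) converge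 for every such $\gamma$, and their values do not depend on $\gamma$. For the quantum (1,4) curve, $$V(\lambda_\infty,t,\nu_\infty;\hbar)=\sum_{m=1}^\infty\frac{B_{m+1}(\nu_\infty)}{m(m+1)}\left(\frac{\hbar}{\lambda_\infty}\right)^m ,$$ where the Bernoulli polynomials $B_m(X)$ are defined by $\frac{we^{Xw}}{e^w-1}=\sum_{m=0}^\infty B_m(X)\frac{w^m}{m!}$. For the quantum (2,3) curve, $V(\lambda_\infty,t,\nu_\infty;\hbar)=0$. -/

import Mathlib

open PowerSeries Filter Topology

noncomputable section

namespace VorosWKB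

/-- The points `z` of the `z`-plane that are neither poles of the covering map `x` (points over
the singular point `x = ∞`) nor zeros of `dx` (turning points). -/
def regularLocus (x : ℂ → ℂ) : Set ℂ := {z | AnalyticAt ℂ x z ∧ deriv x z ≠ 0}

/-- The derivation `ħ d/dx` acting on formal power series in `ħ` (the variable `X`) whose
coefficients are functions of the uniformizing coordinate `z`, where `x = x(z)`, so that
`d/dx = (1 / x'(z)) d/dz`. -/
def hbarD (x : ℂ → ℂ) (f : ℂ → ℂ⟦X⟧) : ℂ → ℂ⟦X⟧ := fun z =>
  X * PowerSeries.mk fun m => deriv (fun w => coeff m (f w)) z / deriv x z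

/-- The Riccati equation of
`{p₀ ħ³ d³/dx³ + p₁ ħ² d²/dx² + p₂ ħ d/dx + p₃} ψ = 0`, `p i = p i (x, ħ)`,
at the point `z`, written for `σ = ħ S`, `S = d/dx log ψ`. Multiplying out,
`ħ³ (S'' + 3 S S' + S³) = (ħ d/dx)² σ + 3 σ (ħ d/dx) σ + σ³` and
`ħ² (S' + S²) = (ħ d/dx) σ + σ²`. -/
def RiccatiAt (p : Fin 4 → ℂ → ℂ⟦X⟧) (x : ℂ → ℂ) (σ : ℂ → ℂ⟦X⟧) (z : ℂ) : Prop :=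
  p 0 (x z) * (hbarD x (hbarD x σ) z + 3 * σ z * hbarD x σ z + σ z ^ 3)
    + p 1 (x z) * (hbarD x σ z + σ z ^ 2) + p 2 (x z) * σ z + p 3 (x z) = 0

/-- `σ = ħ S`, with `S = ħ⁻¹ S₋₁ + S₀ + ħ S₁ + ⋯` the logarithmic derivative of the WKB solution
lifted to the Riemann surface of `S₋₁`, which is uniformized by `z ↦ (x z, y z)`. So the coefficient
of `ħ ^ (m + 1)` in `σ z` is `S_m` at the point `z`, and `S₋₁ = y`. -/
structure IsWKB (p : Fin 4 → ℂ → ℂ⟦X⟧) (x y : ℂ → ℂ) (σ : ℂ → ℂ⟦X⟧) : Prop where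
  holo : ∀ m : ℕ, DifferentiableOn ℂ (fun z => coeff m (σ z)) (regularLocus x)
  leading : ∀ z ∈ regularLocus x, coeff 0 (σ z) = y z
  riccati : ∀ z ∈ regularLocus x, RiccatiAt p x σ z

/-- A (continuously differentiable) path on the Riemann sphere of `z`, parametrized by `(0, 1)`,
from the point `z = 0` to the point `z = ∞`, avoiding the turning points. -/
structure IsVorosPath (x : ℂ → ℂ) (γ : ℝ → ℂ) : Prop where
  smooth : ContDiffOn ℝ 1 γ (Set.Ioo 0 1)
  mem : ∀ s ∈ Set.Ioo (0 : ℝ) 1, γ s ∈ regularLocus x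
  source : Tendsto γ (𝓝[>] 0) (𝓝 0)
  target : Tendsto γ (𝓝[<] 1) (Bornology.cobounded ℂ)

/-- `∫_γ S_m dx = v`, as a convergent (improper at both ends) path integral. -/
def HasPathIntegral (x : ℂ → ℂ) (σ : ℂ → ℂ⟦X⟧) (γ : ℝ → ℂ) (m : ℕ) (v : ℂ) : Prop :=
  Tendsto
    (fun ab : ℝ × ℝ =>
      ∫ s in ab.1..ab.2, coeff (m + 1) (σ (γ s)) * deriv x (γ s) * deriv γ s)
    ((𝓝[>] 0) ×ˢ (𝓝[<] 1)) (𝓝 v)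

/-- The formal power series `V` in `ħ` is the Voros coefficient
`∫_γ (S - ħ⁻¹ S₋₁ - S₀) dx = ∑_{m ≥ 1} ħ ^ m ∫_γ S_m dx`, with `γ` running from `z = 0` to `z = ∞`:
the WKB series and such paths exist, and for all of them the integrals converge to the
coefficients of `V`. -/
def IsVorosCoefficient (p : Fin 4 → ℂ → ℂ⟦X⟧) (x y : ℂ → ℂ) (V : ℂ⟦X⟧) : Prop :=
  (∃ σ, IsWKB p x y σ) ∧ (∃ γ, IsVorosPath x γ) ∧
    ∀ σ γ, IsWKB p x y σ → IsVorosPath x γ →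
      coeff 0 V = 0 ∧ ∀ m : ℕ, 1 ≤ m → HasPathIntegral x σ γ m (coeff m V)

/-- `λ̂ = λ - ν ħ`. -/
def lambdaHat (lam nu : ℂ) : ℂ⟦X⟧ := C lam - C nu * X

/-- The covering map `x(z) = -3 z² - 2 t z + λ / z` of the (1,4) curve
`3 y³ + 2 t y² + x y - λ = 0`, where `y(z) = z`. -/
def x14 (t lam : ℂ) : ℂ → ℂ := fun z => -3 * z ^ 2 - 2 * t * z + lam / z

/-- The coefficients of the quantum (1,4) curve
`{3 ħ³ d³/dx³ + 2 t ħ² d²/dx² + x ħ d/dx - λ̂} ψ = 0`. -/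
def quantumCurve14 (t lam nu : ℂ) : Fin 4 → ℂ → ℂ⟦X⟧ :=
  ![fun _ => 3, fun _ => 2 * C t, fun x => C x, fun _ => -lambdaHat lam nu]

/-- The covering map `x(z) = 2 z + λ / z - t / (2 z²)` of the (2,3) curve
`4 y³ - 2 x y² + 2 λ y - t = 0`, where `y(z) = z`. -/
def x23 (t lam : ℂ) : ℂ → ℂ := fun z => 2 * z + lam / z - t / (2 * z ^ 2)

/-- The coefficients of the quantum (2,3) curve
`{4 ħ³ d³/dx³ - 2 x ħ² d²/dx² + 2 (λ̂ - ħ) ħ d/dx - t} ψ = 0`. -/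
def quantumCurve23 (t lam nu : ℂ) : Fin 4 → ℂ → ℂ⟦X⟧ :=
  ![fun _ => 4, fun x => -2 * C x, fun _ => 2 * (lambdaHat lam nu - X), fun _ => -C t]

end VorosWKB

end

namespace VorosWKB

/-! Both equations are formally solved by Laplace integrals `∫ ξ^(ν-1) exp(φ(ξ)/ħ) dξ` with phase
`φ(ξ) = x ξ + p ξ³ + q ξ² - λ log ξ + r/ξ`. Here `(p, q, r)` is `(1, t, 0)` for (1,4) and `(0, -1,
-t/2)` for (2,3). The saddle point equation `φ'(z) = 0` reads `x = coverX p q λ r z`, so the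
uniformizing coordinate is the saddle point. With `ξ = z (1 + u)` the phase is `φ(z) + hess u²/2 +
tail`.

No integral over `ξ` is taken: `saddle` is the power series produced by Gaussian moments, and it
obeys the rules of integrals, namely integration by parts, differentiation in parameters and
scaling. These rules turn `ħψ'/ψ` into a WKB solution (`isWKB_ratio`), the only one by
`IsWKB.eq_of_isWKB`. The leading factor of the integral affects only `S₋₁` and `S₀`, so the
logarithm of the remaining series is a single-valued primitive of `S_m dx` for `m ≥ 1`
(`hasDerivAt_coeff_formalLog_psi`). The Voros coefficient is therefore a difference of two endpoint
limits, whatever the path.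

The effective small parameter is `ħ / hess`. At `z = ∞`, and at `z = 0` when `r ≠ 0`, `hess` is
infinite, the series tends to `1` and its logarithm to `0`; this settles (2,3). For (1,4), `hess →
λ` at `z = 0` and the limit is `gammaSaddle`, the expansion of `∫ ξ^(ν-1) exp(λ (ξ - log ξ)/ħ) dξ`.
Its logarithm is minus the Stirling series (`coeff_formalLog_gammaSaddle`): the shift `ν → ν + 1`
and a differential equation in `ν` together determine it. -/

/-! ### Coefficientwise derivatives and limits of families of power series -/

/-- The coefficients of `F` have the coefficients of `F'` as derivatives at `z`. -/
def HasCoeffDerivAt (F : ℂ → ℂ⟦X⟧) (F' : ℂ⟦X⟧) (z : ℂ) : Prop :=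
  ∀ n, HasDerivAt (fun w => coeff n (F w)) (coeff n F') z

/-- Coefficientwise convergence of power series. -/
def CoeffTendsto {α : Type*} (F : α → ℂ⟦X⟧) (l : Filter α) (G : ℂ⟦X⟧) : Prop :=
  ∀ n, Tendsto (fun a => coeff n (F a)) l (𝓝 (coeff n G))

namespace HasCoeffDerivAt

variable {F G : ℂ → ℂ⟦X⟧} {F' G' : ℂ⟦X⟧} {z : ℂ}

theorem const (f : ℂ⟦X⟧) (z : ℂ) : HasCoeffDerivAt (fun _ => f) 0 z := fun n => by
  simpa using hasDerivAt_const z (coeff n f)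

theorem congr_deriv (h : HasCoeffDerivAt F F' z) (e : F' = G') : HasCoeffDerivAt F G' z := e ▸ h

theorem unique (h : HasCoeffDerivAt F F' z) (h' : HasCoeffDerivAt F G' z) : F' = G' := by
  ext n
  exact (h n).unique (h' n)

theorem add (hF : HasCoeffDerivAt F F' z) (hG : HasCoeffDerivAt G G' z) :
    HasCoeffDerivAt (fun w => F w + G w) (F' + G') z := fun n => by
  simpa using (hF n).fun_add (hG n)

theorem sub (hF : HasCoeffDerivAt F F' z) (hG : HasCoeffDerivAt G G' z) :
    HasCoeffDerivAt (fun w => F w - G w) (F' - G') z := fun n => by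
  simpa using (hF n).fun_sub (hG n)

theorem mul (hF : HasCoeffDerivAt F F' z) (hG : HasCoeffDerivAt G G' z) :
    HasCoeffDerivAt (fun w => F w * G w) (F' * G z + F z * G') z := fun n => by
  simp only [coeff_mul, map_add, ← Finset.sum_add_distrib]
  exact HasDerivAt.fun_sum fun i _ => (hF i.1).fun_mul (hG i.2)

theorem C {c : ℂ → ℂ} {c' : ℂ} (hc : HasDerivAt c c' z) :
    HasCoeffDerivAt (fun w => PowerSeries.C (c w)) (PowerSeries.C c') z := fun n => by
  simp only [coeff_C]
  split_ifs
  · exact hc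
  · exact hasDerivAt_const z 0

theorem pow (hF : HasCoeffDerivAt F F' z) (k : ℕ) :
    HasCoeffDerivAt (fun w => F w ^ k) (k * F z ^ (k - 1) * F') z := by
  induction k with
  | zero => simpa using const 1 z
  | succ k ih =>
    simp only [pow_succ]
    refine (ih.mul hF).congr_deriv ?_
    rcases k with _ | k
    · simp
    · simp only [Nat.cast_add, Nat.cast_one, Nat.add_sub_cancel, pow_succ]
      ring

theorem inv (hF : HasCoeffDerivAt F F' z) (h1 : ∀ w, constantCoeff (F w) = 1) :
    HasCoeffDerivAt (fun w => (F w)⁻¹) (-(F' * (F z)⁻¹ * (F z)⁻¹)) z := by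
  have hne (w : ℂ) : constantCoeff (F w) ≠ 0 := by simp [h1]
  -- The recursion for the coefficients of an inverse gives differentiability only; the value of the
  -- derivative then follows from differentiating `F * F⁻¹ = 1`.
  have hd (n : ℕ) : DifferentiableAt ℂ (fun w => coeff n (F w)⁻¹) z := by
    induction n using Nat.strong_induction_on with
    | _ n ih =>
      simp only [coeff_inv n, h1]
      split_ifs with hn
      · fun_prop
      · refine DifferentiableAt.const_mul (DifferentiableAt.fun_sum fun x _ => ?_) _
        split_ifs with hx
        · exact (hF x.1).differentiableAt.fun_mul (ih x.2 hx)
        · fun_prop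
  have hD : HasCoeffDerivAt (fun w => (F w)⁻¹)
      (PowerSeries.mk fun n => deriv (fun w => coeff n (F w)⁻¹) z) z := fun n => by
    simpa using (hd n).hasDerivAt
  refine hD.congr_deriv ?_
  have h := hF.mul hD
  simp only [PowerSeries.mul_inv_cancel _ (hne _)] at h
  have h0 := h.unique (const 1 z)
  have hz := PowerSeries.mul_inv_cancel _ (hne z)
  linear_combination (F z)⁻¹ * h0 - (PowerSeries.mk fun n => deriv (fun w => coeff n (F w)⁻¹) z) * hz

theorem derivative (hF : HasCoeffDerivAt F F' z) :
    HasCoeffDerivAt (fun w => d⁄dX ℂ (F w)) (d⁄dX ℂ F') z := fun n => by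
  simp only [coeff_derivative]
  exact (hF (n + 1)).mul_const _

end HasCoeffDerivAt

namespace CoeffTendsto

variable {α : Type*} {l : Filter α} {F G : α → ℂ⟦X⟧} {f g : ℂ⟦X⟧}

theorem const (f : ℂ⟦X⟧) : CoeffTendsto (fun _ => f) l f := fun _ => tendsto_const_nhds

theorem congr (h : CoeffTendsto F l f) (e : ∀ a, F a = G a) : CoeffTendsto G l f :=
  fun n => (h n).congr fun a => by rw [e]

theorem add (hF : CoeffTendsto F l f) (hG : CoeffTendsto G l g) :
    CoeffTendsto (fun a => F a + G a) l (f + g) := fun n => by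
  simpa using (hF n).add (hG n)

theorem mul (hF : CoeffTendsto F l f) (hG : CoeffTendsto G l g) :
    CoeffTendsto (fun a => F a * G a) l (f * g) := fun n => by
  simp only [coeff_mul]
  exact tendsto_finsetSum _ fun i _ => (hF i.1).mul (hG i.2)

theorem C {c : α → ℂ} {d : ℂ} (hc : Tendsto c l (𝓝 d)) :
    CoeffTendsto (fun a => PowerSeries.C (c a)) l (PowerSeries.C d) := fun n => by
  simp only [coeff_C]
  split_ifs
  · exact hc
  · exact tendsto_const_nhds

theorem pow (hF : CoeffTendsto F l f) (k : ℕ) : CoeffTendsto (fun a => F a ^ k) l (f ^ k) := by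
  induction k with
  | zero => simpa using const 1
  | succ k ih => simpa only [pow_succ] using ih.mul hF

theorem inv (hF : CoeffTendsto F l f) (h1 : ∀ a, constantCoeff (F a) = 1)
    (h1' : constantCoeff f = 1) : CoeffTendsto (fun a => (F a)⁻¹) l f⁻¹ := fun n => by
  induction n using Nat.strong_induction_on with
  | _ n ih =>
    simp only [coeff_inv n, h1, h1']
    split_ifs with hn
    · exact tendsto_const_nhds
    · refine Tendsto.const_mul _ (tendsto_finsetSum _ fun x _ => ?_)
      split_ifs with hx
      · exact (hF x.1).mul (ih x.2 hx)
      · exact tendsto_const_nhds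

theorem derivative (hF : CoeffTendsto F l f) :
    CoeffTendsto (fun a => d⁄dX ℂ (F a)) l (d⁄dX ℂ f) := fun n => by
  simp only [coeff_derivative]
  exact (hF (n + 1)).mul_const _

end CoeffTendsto

/-! ### The formal logarithm -/

/-- The logarithm of a power series with constant coefficient `1`, defined by integrating its
logarithmic derivative. -/
noncomputable def formalLog (f : ℂ⟦X⟧) : ℂ⟦X⟧ :=
  PowerSeries.mk fun n => coeff n (X * d⁄dX ℂ f * f⁻¹) / n

theorem coeff_X_mul_derivative (f : ℂ⟦X⟧) (n : ℕ) :
    coeff n (X * d⁄dX ℂ f) = n * coeff n f := by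
  cases n with
  | zero => simp
  | succ n => rw [coeff_succ_X_mul, coeff_derivative]; push_cast; ring

theorem X_mul_derivative_formalLog (f : ℂ⟦X⟧) :
    X * d⁄dX ℂ (formalLog f) = X * d⁄dX ℂ f * f⁻¹ := by
  ext n
  rw [coeff_X_mul_derivative, formalLog, coeff_mk]
  cases n with
  | zero => simp
  | succ n => field_simp

theorem formalLog_mul {f g : ℂ⟦X⟧} (hf : constantCoeff f = 1) (hg : constantCoeff g = 1) :
    formalLog (f * g) = formalLog f + formalLog g := by
  have h : X * d⁄dX ℂ (f * g) * (f * g)⁻¹ = X * d⁄dX ℂ f * f⁻¹ + X * d⁄dX ℂ g * g⁻¹ := by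
    have h1 := PowerSeries.mul_inv_cancel f (by simp [hf])
    have h2 := PowerSeries.mul_inv_cancel g (by simp [hg])
    rw [Derivation.leibniz, PowerSeries.mul_inv_rev]
    simp only [smul_eq_mul]
    linear_combination X * d⁄dX ℂ g * g⁻¹ * h1 + X * d⁄dX ℂ f * f⁻¹ * h2
  ext n
  simp only [formalLog, coeff_mk, h, map_add, add_div]

theorem HasCoeffDerivAt.formalLog {F : ℂ → ℂ⟦X⟧} {F' : ℂ⟦X⟧} {z : ℂ}
    (hF : HasCoeffDerivAt F F' z) (h1 : ∀ w, constantCoeff (F w) = 1) :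
    HasCoeffDerivAt (fun w => formalLog (F w)) (F' * (F z)⁻¹) z := fun n => by
  have h := (((HasCoeffDerivAt.const X z).mul hF.derivative).mul (hF.inv h1)) n
  have e : (0 * d⁄dX ℂ (F z) + X * d⁄dX ℂ F') * (F z)⁻¹ +
      X * d⁄dX ℂ (F z) * -(F' * (F z)⁻¹ * (F z)⁻¹) = X * d⁄dX ℂ (F' * (F z)⁻¹) := by
    rw [Derivation.leibniz, derivative_inv']
    simp only [smul_eq_mul]
    ring
  rw [e, coeff_X_mul_derivative] at h
  simp only [VorosWKB.formalLog, coeff_mk]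
  -- For `n = 0` the coefficient of `formalLog` is a quotient by `0`, hence `0`, and `F'` has no
  -- constant term because that of `F` is constantly `1`.
  rcases Nat.eq_zero_or_pos n with rfl | hn
  · have h0 := hF 0
    simp only [coeff_zero_eq_constantCoeff, h1] at h0
    have := h0.unique (hasDerivAt_const z (1 : ℂ))
    simpa [this] using hasDerivAt_const z (0 : ℂ)
  · have hn' : (n : ℂ) ≠ 0 := by exact_mod_cast hn.ne'
    simpa [hn'] using h.div_const (n : ℂ)

theorem CoeffTendsto.formalLog {α : Type*} {l : Filter α} {F : α → ℂ⟦X⟧} {f : ℂ⟦X⟧}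
    (hF : CoeffTendsto F l f) (h1 : ∀ a, constantCoeff (F a) = 1) (h1' : constantCoeff f = 1) :
    CoeffTendsto (fun a => formalLog (F a)) l (formalLog f) := fun n => by
  simp only [VorosWKB.formalLog, coeff_mk]
  exact ((((CoeffTendsto.const X).mul hF.derivative).mul (hF.inv h1 h1')) n).div_const _

theorem formalLog_one : formalLog 1 = 0 := by
  ext n
  simp [formalLog]

/-! ### The formal saddle point expansion and its calculus -/

/-- The moments `∏_{i < n} (-(2 i + 1) / A)` of the Gaussian weight `exp (A u ^ 2 / 2)`. -/
noncomputable def gaussianMoment (A : ℂ) (n : ℕ) : ℂ :=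
  ∏ i ∈ Finset.range n, (-(2 * (i : ℂ) + 1) / A)

/-- The term of order `ħ ^ m` and degree `k` in `R` of the formal saddle point expansion. -/
noncomputable def saddleTerm (A : ℂ) (R G : ℂ⟦X⟧) (m k : ℕ) : ℂ :=
  (1 / (k.factorial : ℂ)) * gaussianMoment A (m + k) * coeff (2 * (m + k)) (G * R ^ k)

/-- The formal saddle point expansion, as a power series in `ħ`, of the integral of
`G(u) exp (ħ⁻¹ (A u ^ 2 / 2 + R(u)))`, divided by its leading factor. -/
noncomputable def saddle (A : ℂ) (R G : ℂ⟦X⟧) : ℂ⟦X⟧ :=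
  PowerSeries.mk fun m => ∑ k ∈ Finset.range (2 * m + 1), saddleTerm A R G m k

theorem gaussianMoment_succ (A : ℂ) (n : ℕ) :
    gaussianMoment A (n + 1) = gaussianMoment A n * (-(2 * (n : ℂ) + 1) / A) :=
  Finset.prod_range_succ _ _

theorem gaussianMoment_eq (A : ℂ) (n : ℕ) :
    gaussianMoment A n = gaussianMoment 1 n * A⁻¹ ^ n := by
  induction n with
  | zero => simp [gaussianMoment]
  | succ n ih => rw [gaussianMoment_succ, gaussianMoment_succ, ih, pow_succ]; ring

theorem coeff_mul_pow_eq_zero {R : ℂ⟦X⟧} (hR : X ^ 3 ∣ R) (G : ℂ⟦X⟧) {n k : ℕ} (h : n < 3 * k) :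
    coeff n (G * R ^ k) = 0 := by
  have : X ^ (3 * k) ∣ G * R ^ k := by
    rw [pow_mul]
    exact (pow_dvd_pow_of_dvd hR k).mul_left _
  exact X_pow_dvd_iff.1 this n h

/-- Each factor `R` costs one `ħ⁻¹` but brings at least `u³`, so only `3 k ≤ 2 (m + k)` contributes.
This is why the sum in `saddle` may stop at `k = 2 m`. -/
theorem saddleTerm_eq_zero {R : ℂ⟦X⟧} (hR : X ^ 3 ∣ R) (A : ℂ) (G : ℂ⟦X⟧) {m k : ℕ}
    (h : 2 * m < k) : saddleTerm A R G m k = 0 := by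
  rw [saddleTerm, coeff_mul_pow_eq_zero hR G (by lia), mul_zero]

theorem coeff_saddle {R : ℂ⟦X⟧} (hR : X ^ 3 ∣ R) (A : ℂ) (G : ℂ⟦X⟧) (m : ℕ) {N : ℕ}
    (h : 2 * m + 1 ≤ N) :
    coeff m (saddle A R G) = ∑ k ∈ Finset.range N, saddleTerm A R G m k := by
  rw [saddle, coeff_mk]
  refine Finset.sum_subset (Finset.range_mono h) fun k _ hk => ?_
  exact saddleTerm_eq_zero hR A G (by simpa [Nat.lt_succ_iff] using hk)

theorem constantCoeff_saddle (A : ℂ) (R G : ℂ⟦X⟧) :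
    constantCoeff (saddle A R G) = constantCoeff G := by
  rw [← coeff_zero_eq_constantCoeff_apply, saddle, coeff_mk]
  simp [saddleTerm, gaussianMoment]

theorem saddle_add (A : ℂ) (R G H : ℂ⟦X⟧) :
    saddle A R (G + H) = saddle A R G + saddle A R H := by
  ext m
  simp only [saddle, coeff_mk, map_add, ← Finset.sum_add_distrib, saddleTerm, add_mul, mul_add]

theorem saddle_C_mul (A : ℂ) (R : ℂ⟦X⟧) (c : ℂ) (G : ℂ⟦X⟧) :
    saddle A R (C c * G) = C c * saddle A R G := by
  ext m
  simp only [saddle, coeff_mk, coeff_C_mul, Finset.mul_sum, saddleTerm, mul_assoc]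
  refine Finset.sum_congr rfl fun k _ => ?_
  ring

/-- Shift of the summation index when a factor of `R` is produced by differentiation. -/
theorem sum_mul_saddleTerm_shift {R : ℂ⟦X⟧} (hR : X ^ 3 ∣ R) (A : ℂ) (H : ℂ⟦X⟧) (m : ℕ) {N : ℕ}
    (hN : 2 * m + 4 ≤ N) :
    ∑ k ∈ Finset.range N, (1 / (k.factorial : ℂ)) * gaussianMoment A (m + k) *
      (k * coeff (2 * (m + k)) (H * R ^ (k - 1))) = coeff (m + 1) (saddle A R H) := by
  obtain ⟨N, rfl⟩ : ∃ M, N = M + 1 := ⟨N - 1, by lia⟩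
  rw [coeff_saddle hR A H (m + 1) (N := N) (by lia), Finset.sum_range_succ']
  simp only [Nat.cast_zero, zero_mul, mul_zero, add_zero]
  refine Finset.sum_congr rfl fun k _ => ?_
  have hk : ((k : ℂ) + 1) ≠ 0 := by exact_mod_cast k.succ_ne_zero
  have hk' : (k.factorial : ℂ) ≠ 0 := by exact_mod_cast k.factorial_ne_zero
  rw [saddleTerm, show m + (k + 1) = m + 1 + k by ring, Nat.factorial_succ, Nat.add_sub_cancel]
  push_cast
  field_simp

/-- Integration by parts. -/
theorem saddle_integration_by_parts {A : ℂ} (hA : A ≠ 0) {R : ℂ⟦X⟧} (hR : X ^ 3 ∣ R) (G : ℂ⟦X⟧) :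
    saddle A R ((C A * X + d⁄dX ℂ R) * G) = -(X * saddle A R (d⁄dX ℂ G)) := by
  rw [eq_neg_iff_add_eq_zero]
  ext m
  cases m with
  | zero =>
    obtain ⟨S, rfl⟩ := hR
    have : coeff 1 (X ^ 3 * S) = 0 := X_pow_dvd_iff.1 (dvd_mul_right _ S) 1 (by norm_num)
    simp only [map_add, coeff_zero_eq_constantCoeff, constantCoeff_saddle, map_mul]
    rw [← coeff_zero_eq_constantCoeff_apply (d⁄dX ℂ (X ^ 3 * S)), coeff_derivative]
    simp [this]
  | succ m =>
    rw [add_mul, saddle_add, map_add, map_add, coeff_succ_X_mul, map_zero, mul_comm (d⁄dX ℂ R),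
      ← sum_mul_saddleTerm_shift hR A (G * d⁄dX ℂ R) m le_rfl,
      coeff_saddle hR A _ m (N := 2 * m + 4) (by lia),
      coeff_saddle hR A _ (m + 1) (N := 2 * m + 4) (by lia),
      ← Finset.sum_add_distrib, ← Finset.sum_add_distrib]
    -- Once the `R'` term is shifted, the sum vanishes for each `k` separately: the product rule for
    -- `G R ^ k` meets the recursion of the Gaussian moments.
    refine Finset.sum_eq_zero fun k _ => ?_
    have h1 : coeff (2 * (m + 1 + k)) (C A * X * G * R ^ k)
        = A * coeff (2 * (m + k) + 1) (G * R ^ k) := by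
      rw [show 2 * (m + 1 + k) = 2 * (m + k) + 1 + 1 by ring,
        show C A * X * G * R ^ k = C A * (X * (G * R ^ k)) by ring, coeff_C_mul, coeff_succ_X_mul]
    have h2 : coeff (2 * (m + k)) (d⁄dX ℂ G * R ^ k)
        + k * coeff (2 * (m + k)) (G * d⁄dX ℂ R * R ^ (k - 1))
        = coeff (2 * (m + k) + 1) (G * R ^ k) * (2 * (m + k) + 1) := by
      have := coeff_derivative (G * R ^ k) (2 * (m + k))
      rw [Derivation.leibniz, derivative_pow] at this
      push_cast at this
      rw [← this, ← nsmul_eq_mul, ← map_nsmul, ← map_add]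
      congr 1
      simp only [smul_eq_mul, nsmul_eq_mul]
      ring
    rw [saddleTerm, saddleTerm, h1, show m + 1 + k = m + k + 1 by ring, gaussianMoment_succ]
    have h3 : -(2 * ((m + k : ℕ) : ℂ) + 1) / A * A = -(2 * ((m : ℂ) + k) + 1) := by
      push_cast
      field_simp
    linear_combination (1 / (k.factorial : ℂ)) * gaussianMoment A (m + k) *
      (coeff (2 * (m + k) + 1) (G * R ^ k) * h3 + h2)

theorem hasDerivAt_gaussianMoment {A : ℂ → ℂ} {A' z : ℂ} (h : HasDerivAt A A' z) (hA : A z ≠ 0)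
    (n : ℕ) : HasDerivAt (fun w => gaussianMoment (A w) n)
      (-n * (A' / A z) * gaussianMoment (A z) n) z := by
  simp only [gaussianMoment_eq (A _) n]
  have := ((h.fun_inv hA).fun_pow n).const_mul (gaussianMoment 1 n)
  refine this.congr_deriv ?_
  cases n with
  | zero => simp
  | succ n =>
    simp only [Nat.add_sub_cancel, pow_succ]
    field_simp

/-- Differentiation of the saddle point expansion with respect to a parameter. -/
theorem hasCoeffDerivAt_saddle {A : ℂ → ℂ} {A' z : ℂ} (h : HasDerivAt A A' z) (hA : A z ≠ 0)
    {R G : ℂ → ℂ⟦X⟧} {R' G' : ℂ⟦X⟧} (hR : HasCoeffDerivAt R R' z) (hG : HasCoeffDerivAt G G' z)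
    (hR3 : ∀ w, X ^ 3 ∣ R w) (m : ℕ) :
    HasDerivAt (fun w => coeff m (saddle (A w) (R w) (G w)))
      (coeff m (saddle (A z) (R z) G') +
        coeff (m + 1) (saddle (A z) (R z) (G z * (C (A' / 2) * X ^ 2 + R'))) +
        A' / (2 * A z) * coeff m (saddle (A z) (R z) (G z))) z := by
  have hs (k : ℕ) : HasDerivAt (fun w => saddleTerm (A w) (R w) (G w) m k)
      ((1 / (k.factorial : ℂ)) * (-(m + k : ℕ) * (A' / A z) * gaussianMoment (A z) (m + k)) *
        coeff (2 * (m + k)) (G z * R z ^ k) + (1 / (k.factorial : ℂ)) * gaussianMoment (A z) (m + k)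
        * coeff (2 * (m + k)) (G' * R z ^ k + G z * ((k : ℂ⟦X⟧) * R z ^ (k - 1) * R'))) z :=
    ((hasDerivAt_gaussianMoment h hA (m + k)).const_mul _).fun_mul ((hG.mul (hR.pow k)) _)
  simp only [coeff_saddle (hR3 _) (A _) (G _) m (N := 2 * m + 4) (by lia)]
  refine (HasDerivAt.fun_sum fun k _ => hs k).congr_deriv ?_
  -- The exponential brings down `ħ⁻¹ (A' u² / 2 + R')`, which moves the order from `m` to `m + 1`;
  -- the term `A' / (2 A)` compensates the division by the leading factor, proportional to `A ^
  -- (-1/2)`.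
  rw [mul_add, saddle_add, map_add, ← sum_mul_saddleTerm_shift (hR3 z) (A z) (G z * R') m le_rfl,
      coeff_saddle (hR3 z) _ _ m (N := 2 * m + 4) (by lia),
      coeff_saddle (hR3 z) _ _ (m + 1) (N := 2 * m + 4) (by lia), Finset.mul_sum,
      ← Finset.sum_add_distrib, ← Finset.sum_add_distrib, ← Finset.sum_add_distrib]
  refine Finset.sum_congr rfl fun k _ => ?_
  have h1 : coeff (2 * (m + 1 + k)) (G z * (C (A' / 2) * X ^ 2) * R z ^ k)
      = A' / 2 * coeff (2 * (m + k)) (G z * R z ^ k) := by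
    rw [show 2 * (m + 1 + k) = 2 * (m + k) + 1 + 1 by ring,
      show G z * (C (A' / 2) * X ^ 2) * R z ^ k = C (A' / 2) * (X * (X * (G z * R z ^ k))) by ring,
      coeff_C_mul, coeff_succ_X_mul, coeff_succ_X_mul]
  have h2 : coeff (2 * (m + k)) (G z * ((k : ℂ⟦X⟧) * R z ^ (k - 1) * R'))
      = (k : ℂ) * coeff (2 * (m + k)) (G z * R' * R z ^ (k - 1)) := by
    rw [← nsmul_eq_mul, ← nsmul_eq_mul, ← map_nsmul]
    congr 1
    simp only [nsmul_eq_mul]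
    ring
  rw [saddleTerm, saddleTerm, saddleTerm, h1, show m + 1 + k = m + k + 1 by ring,
    gaussianMoment_succ, map_add, h2]
  push_cast
  field_simp
  ring

/-- The saddle point expansion depends on `A` and `R` only through `A⁻¹` and `A⁻¹ R`. -/
theorem saddleTerm_eq (A : ℂ) (R G : ℂ⟦X⟧) (m k : ℕ) :
    saddleTerm A R G m k = (1 / (k.factorial : ℂ)) * gaussianMoment 1 (m + k) * A⁻¹ ^ m *
      coeff (2 * (m + k)) (G * (C A⁻¹ * R) ^ k) := by
  rw [saddleTerm, gaussianMoment_eq, mul_pow, ← map_pow, mul_left_comm G, coeff_C_mul, pow_add]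
  ring

theorem coeffTendsto_saddle {α : Type*} {l : Filter α} {A : α → ℂ} {B : ℂ} {R : α → ℂ⟦X⟧}
    {S : ℂ⟦X⟧} (hA : Tendsto A l (𝓝 B)) (hB : B ≠ 0)
    (hR : CoeffTendsto (fun a => C (A a)⁻¹ * R a) l (C B⁻¹ * S)) (G : ℂ⟦X⟧) :
    CoeffTendsto (fun a => saddle (A a) (R a) G) l (saddle B S G) := fun m => by
  simp only [saddle, coeff_mk, saddleTerm_eq]
  exact tendsto_finsetSum _ fun k _ => (((hA.inv₀ hB).pow m).const_mul _).mul
    (((CoeffTendsto.const G).mul (hR.pow k)) _)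

/-- By `saddleTerm_eq` the order `m` carries `A⁻¹ ^ m` times an expression in `A⁻¹ R`. When the
latter converges, all positive orders die as `A → ∞`. -/
theorem coeffTendsto_saddle_of_inv_tendsto_zero {α : Type*} {l : Filter α} {A : α → ℂ}
    {R : α → ℂ⟦X⟧} {S : ℂ⟦X⟧} (hA : Tendsto (fun a => (A a)⁻¹) l (𝓝 0))
    (hR : CoeffTendsto (fun a => C (A a)⁻¹ * R a) l S) (G : ℂ⟦X⟧) :
    CoeffTendsto (fun a => saddle (A a) (R a) G) l (C (constantCoeff G)) := fun m => by
  cases m with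
  | zero =>
    simp only [coeff_zero_eq_constantCoeff, constantCoeff_saddle, constantCoeff_C]
    exact tendsto_const_nhds
  | succ m =>
    simp only [saddle, coeff_mk, saddleTerm_eq]
    have h : coeff (m + 1) (C (constantCoeff G)) = ∑ k ∈ Finset.range (2 * (m + 1) + 1),
        (1 / (k.factorial : ℂ)) * gaussianMoment 1 (m + 1 + k) * 0 ^ (m + 1) *
          coeff (2 * (m + 1 + k)) (G * S ^ k) := by
      simp
    rw [h]
    exact tendsto_finsetSum _ fun k _ => ((hA.pow (m + 1)).const_mul _).mul
      (((CoeffTendsto.const G).mul (hR.pow k)) _)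

/-- Scaling the phase is the same as scaling `ħ`. -/
theorem coeff_saddle_mul {A : ℂ} (hA : A ≠ 0) (R G : ℂ⟦X⟧) {c : ℂ} (hc : c ≠ 0) (m : ℕ) :
    coeff m (saddle (c * A) (C c * R) G) = c⁻¹ ^ m * coeff m (saddle A R G) := by
  simp only [saddle, coeff_mk, saddleTerm_eq, Finset.mul_sum]
  refine Finset.sum_congr rfl fun k _ => ?_
  have : C (c * A)⁻¹ * (C c * R) = C A⁻¹ * R := by
    rw [← mul_assoc, ← map_mul]
    congr 2
    field_simp
  rw [this, mul_inv, mul_pow]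
  ring

/-- The Euler relation: the expansion with the phase itself as amplitude. -/
theorem coeff_saddle_phase {A : ℂ} (hA : A ≠ 0) {R : ℂ⟦X⟧} (hR : X ^ 3 ∣ R) (G : ℂ⟦X⟧) (m : ℕ) :
    coeff (m + 1) (saddle A R (G * (C (A / 2) * X ^ 2 + R))) =
      -(m + 1 / 2) * coeff m (saddle A R G) := by
  -- The expansion with phase multiplied by `w` is differentiated at `w = 1` in two ways, by the
  -- general formula and by the scaling law `w⁻¹ ^ m`. The `1 / 2` is the contribution of the
  -- leading factor.
  have hR' : HasCoeffDerivAt (fun w => C w * R) R 1 :=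
    ((HasCoeffDerivAt.C (hasDerivAt_id (1 : ℂ))).mul (HasCoeffDerivAt.const R 1)).congr_deriv
      (by simp)
  have hA' : HasDerivAt (fun w : ℂ => w * A) A 1 := by
    simpa using (hasDerivAt_id (1 : ℂ)).mul_const A
  have h := hasCoeffDerivAt_saddle hA' (by simpa using hA) hR' (HasCoeffDerivAt.const G 1)
    (fun w => hR.mul_left _) m
  have hp : HasDerivAt (fun w : ℂ => w⁻¹ ^ m * coeff m (saddle A R G))
      (-m * coeff m (saddle A R G)) 1 := by
    refine (((hasDerivAt_inv (one_ne_zero (α := ℂ))).fun_pow m).mul_const _).congr_deriv ?_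
    simp
  have he : (fun w : ℂ => w⁻¹ ^ m * coeff m (saddle A R G)) =ᶠ[𝓝 1]
      fun w => coeff m (saddle (w * A) (C w * R) G) := by
    filter_upwards [isOpen_ne.mem_nhds (one_ne_zero (α := ℂ))] with w hw
    exact (coeff_saddle_mul hA R G hw m).symm
  have h0 : saddle A R 0 = 0 := by simpa using saddle_C_mul A R 0 0
  have := (h.congr_of_eventuallyEq he).unique hp
  simp only [map_one, one_mul, h0, map_zero] at this
  have h2 : A / (2 * A) = 1 / 2 := by field_simp
  rw [h2] at this
  linear_combination this

/-! ### The binomial series as a function of its exponent -/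

/-- The binomial series `(1 + X) ^ s`. -/
noncomputable def binom (s : ℂ) : ℂ⟦X⟧ :=
  PowerSeries.mk fun n => ∏ i ∈ Finset.range n, ((s - i) / (i + 1))

theorem coeff_binom_succ (s : ℂ) (n : ℕ) :
    coeff (n + 1) (binom s) = coeff n (binom s) * ((s - n) / (n + 1)) := by
  simp only [binom, coeff_mk, Finset.prod_range_succ]

theorem constantCoeff_binom (s : ℂ) : constantCoeff (binom s) = 1 := by
  rw [← coeff_zero_eq_constantCoeff_apply, binom, coeff_mk]
  simp

theorem coeff_one_add_X_mul_derivative (f : ℂ⟦X⟧) (n : ℕ) :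
    coeff n ((1 + X) * d⁄dX ℂ f) = (n + 1) * coeff (n + 1) f + n * coeff n f := by
  rw [add_mul, one_mul, map_add, coeff_X_mul_derivative, coeff_derivative]
  ring

theorem one_add_X_mul_derivative_binom (s : ℂ) :
    (1 + X) * d⁄dX ℂ (binom s) = C s * binom s := by
  ext n
  have hn : (n : ℂ) + 1 ≠ 0 := by exact_mod_cast n.succ_ne_zero
  rw [coeff_one_add_X_mul_derivative, coeff_C_mul, coeff_binom_succ]
  field_simp
  ring

theorem binom_add_one (s : ℂ) : binom (s + 1) = (1 + X) * binom s := by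
  ext n
  induction n with
  | zero => simp [constantCoeff_binom]
  | succ n ih =>
    have hn : (n : ℂ) + 1 ≠ 0 := by exact_mod_cast n.succ_ne_zero
    rw [coeff_binom_succ, ih, add_mul, one_mul, map_add, map_add, coeff_succ_X_mul]
    cases n with
    | zero => simp [coeff_binom_succ, constantCoeff_binom]
    | succ n =>
      have hn' : (n : ℂ) + 1 ≠ 0 := by exact_mod_cast n.succ_ne_zero
      rw [coeff_succ_X_mul, coeff_binom_succ s (n + 1), coeff_binom_succ s n]
      push_cast at hn ⊢
      field_simp
      ring

theorem derivative_one_add_X_mul_binom (s : ℂ) :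
    d⁄dX ℂ ((1 + X) * binom s) = C (s + 1) * binom s := by
  rw [Derivation.leibniz]
  simp only [map_add, derivative_one, derivative_X, smul_eq_mul, zero_add, mul_one, map_one,
    one_add_X_mul_derivative_binom]
  ring

theorem one_add_X_mul_derivative_log : (1 + X) * d⁄dX ℂ (PowerSeries.log ℂ) = 1 := by
  ext n
  have hn : (n : ℂ) + 1 ≠ 0 := by exact_mod_cast n.succ_ne_zero
  rw [coeff_one_add_X_mul_derivative, coeff_log, coeff_log]
  rcases n with _ | n
  · simp
  · have hn' : (n : ℂ) + 1 ≠ 0 := by exact_mod_cast n.succ_ne_zero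
    simp [coeff_one, pow_succ]
    push_cast at hn
    field_simp
    ring

theorem hasCoeffDerivAt_binom (s : ℂ) :
    HasCoeffDerivAt binom (PowerSeries.log ℂ * binom s) s := fun n => by
  induction n with
  | zero =>
    simp only [coeff_zero_eq_constantCoeff, constantCoeff_binom]
    simpa using hasDerivAt_const s (1 : ℂ)
  | succ n ih =>
    have hn : (n : ℂ) + 1 ≠ 0 := by exact_mod_cast n.succ_ne_zero
    simp only [coeff_binom_succ]
    refine (ih.fun_mul (((hasDerivAt_id s).sub_const (n : ℂ)).div_const _)).congr_deriv ?_
    -- The `n`-th coefficient of this differential equation is the recursion obtained by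
    -- differentiating `coeff_binom_succ` in `s`.
    have h : (1 + X) * d⁄dX ℂ (PowerSeries.log ℂ * binom s)
        = binom s + C s * (PowerSeries.log ℂ * binom s) := by
      rw [Derivation.leibniz]
      simp only [smul_eq_mul]
      linear_combination PowerSeries.log ℂ * one_add_X_mul_derivative_binom s
        + binom s * one_add_X_mul_derivative_log
    have := congrArg (coeff n) h
    rw [coeff_one_add_X_mul_derivative, map_add, coeff_C_mul] at this
    simp only [id]
    field_simp
    linear_combination -this

/-! ### The Gamma integral and Stirling's series -/

/-- `u - log (1 + u) - u ^ 2 / 2`. -/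
noncomputable def logTail : ℂ⟦X⟧ := X - PowerSeries.log ℂ - C (1 / 2) * X ^ 2

theorem X_pow_three_dvd_logTail : X ^ 3 ∣ logTail := by
  rw [X_pow_dvd_iff]
  intro n hn
  interval_cases n <;> norm_num [logTail, coeff_X, coeff_X_pow]

theorem one_add_X_mul_derivative_logTail : (1 + X) * d⁄dX ℂ logTail = -X ^ 2 := by
  have h : d⁄dX ℂ logTail = 1 - d⁄dX ℂ (PowerSeries.log ℂ) - X := by
    have h2 : (C (1 / 2) : ℂ⟦X⟧) * 2 = 1 := by
      rw [show (2 : ℂ⟦X⟧) = C 2 from rfl, ← map_mul]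
      norm_num
    simp only [logTail, map_sub, Derivation.leibniz, derivative_X, derivative_C, derivative_pow,
      smul_eq_mul, mul_zero, add_zero]
    push_cast
    linear_combination -X * h2
  rw [h]
  linear_combination -one_add_X_mul_derivative_log

theorem saddle_neg (A : ℂ) (R G : ℂ⟦X⟧) : saddle A R (-G) = -saddle A R G := by
  simpa using saddle_C_mul A R (-1) G

theorem hasCoeffDerivAt_saddle_amplitude {A : ℂ} (hA : A ≠ 0) {R : ℂ⟦X⟧} (hR : X ^ 3 ∣ R)
    {G : ℂ → ℂ⟦X⟧} {G' : ℂ⟦X⟧} {z : ℂ} (hG : HasCoeffDerivAt G G' z) :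
    HasCoeffDerivAt (fun w => saddle A R (G w)) (saddle A R G') z := fun m => by
  have h0 : saddle A R 0 = 0 := by simpa using saddle_C_mul A R 0 0
  simpa [h0] using hasCoeffDerivAt_saddle (hasDerivAt_const z A) hA (HasCoeffDerivAt.const R z) hG
    (fun _ => hR) m

/-- The formal saddle point expansion of a Gamma integral. -/
noncomputable def gammaSaddle (lam nu : ℂ) : ℂ⟦X⟧ :=
  saddle lam (C lam * logTail) (binom (nu - 1))

theorem constantCoeff_gammaSaddle (lam nu : ℂ) : constantCoeff (gammaSaddle lam nu) = 1 := by
  rw [gammaSaddle, constantCoeff_saddle, constantCoeff_binom]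

theorem C_mul_saddle_X_mul_binom {lam : ℂ} (hlam : lam ≠ 0) (nu : ℂ) :
    C lam * saddle lam (C lam * logTail) (X * binom (nu - 1)) =
      -(C nu * X * gammaSaddle lam nu) := by
  have h := saddle_integration_by_parts hlam (X_pow_three_dvd_logTail.mul_left (C lam))
    ((1 + X) * binom (nu - 1))
  rw [derivative_one_add_X_mul_binom, sub_add_cancel, saddle_C_mul] at h
  rw [← saddle_C_mul, gammaSaddle, show C lam * (X * binom (nu - 1)) =
    (C lam * X + d⁄dX ℂ (C lam * logTail)) * ((1 + X) * binom (nu - 1)) from ?_, h]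
  · ring
  · rw [Derivation.leibniz, derivative_C]
    simp only [smul_eq_mul, mul_zero, add_zero]
    linear_combination -C lam * binom (nu - 1) * one_add_X_mul_derivative_logTail

/-- The formal counterpart of `Γ(s + 1) = s Γ(s)`: raising `ν` inserts the factor `1 + u`, and
integration by parts evaluates the `u`. -/
theorem gammaSaddle_add_one {lam : ℂ} (hlam : lam ≠ 0) (nu : ℂ) :
    gammaSaddle lam (nu + 1) = (1 - C (nu / lam) * X) * gammaSaddle lam nu := by
  have h := C_mul_saddle_X_mul_binom hlam nu
  have hc : (C lam⁻¹ : ℂ⟦X⟧) * C lam = 1 := by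
    rw [← map_mul, inv_mul_cancel₀ hlam, map_one]
  have hd : (C (nu / lam) : ℂ⟦X⟧) = C lam⁻¹ * C nu := by
    rw [← map_mul]
    congr 1
    ring
  have hs : gammaSaddle lam (nu + 1) = gammaSaddle lam nu +
      saddle lam (C lam * logTail) (X * binom (nu - 1)) := by
    rw [gammaSaddle, gammaSaddle, ← saddle_add, show nu + 1 - 1 = nu - 1 + 1 by ring,
      binom_add_one, add_mul, one_mul]
  rw [hs, hd]
  linear_combination C lam⁻¹ * h - saddle lam (C lam * logTail) (X * binom (nu - 1)) * hc

theorem C_mul_saddle_log_mul_binom {lam : ℂ} (hlam : lam ≠ 0) (nu : ℂ) :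
    C lam * saddle lam (C lam * logTail) (PowerSeries.log ℂ * binom (nu - 1)) =
      X * (C (1 / 2 - nu) * gammaSaddle lam nu + X * d⁄dX ℂ (gammaSaddle lam nu)) := by
  -- The phase is `λ (u - log (1 + u))`, so `λ log (1 + u)` is `λ u` minus the phase: integration by
  -- parts handles the first, the Euler relation the second.
  have e : C lam * (PowerSeries.log ℂ * binom (nu - 1)) = C lam * (X * binom (nu - 1)) +
      -(binom (nu - 1) * (C (lam / 2) * X ^ 2 + C lam * logTail)) := by
    have h2 : (C (lam / 2) : ℂ⟦X⟧) = C lam * C (1 / 2) := by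
      rw [← map_mul]
      congr 1
      ring
    rw [h2, logTail]
    ring
  rw [← saddle_C_mul, e, saddle_add, saddle_C_mul, C_mul_saddle_X_mul_binom hlam, saddle_neg]
  ext m
  cases m with
  | zero => simp [constantCoeff_saddle, logTail]
  | succ m =>
    rw [map_add, map_neg, map_neg, coeff_saddle_phase hlam
      (X_pow_three_dvd_logTail.mul_left (C lam)), coeff_succ_X_mul, map_add, coeff_X_mul_derivative,
      coeff_C_mul, mul_right_comm, mul_assoc, coeff_C_mul, mul_comm (gammaSaddle lam nu),
      coeff_succ_X_mul, gammaSaddle]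
    ring

/-- Differentiating in `ν` inserts `log (1 + u)`, which trades for `ħ d/dħ`. Up to a constant at
order zero, the result matches `B_{n+1}' = (n + 1) B_n`. -/
theorem hasDerivAt_coeff_formalLog_gammaSaddle {lam : ℂ} (hlam : lam ≠ 0) (nu : ℂ) (m : ℕ) :
    HasDerivAt (fun w => coeff (m + 1) (formalLog (gammaSaddle lam w)))
      (lam⁻¹ * (coeff m (C (1 / 2 - nu)) + m * coeff m (formalLog (gammaSaddle lam nu)))) nu := by
  have hb : HasCoeffDerivAt (fun w => binom (w - 1)) (PowerSeries.log ℂ * binom (nu - 1)) nu :=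
    fun n => (hasCoeffDerivAt_binom (nu - 1) n).comp_sub_const nu 1
  have h := ((hasCoeffDerivAt_saddle_amplitude hlam
    (X_pow_three_dvd_logTail.mul_left (C lam)) hb).formalLog (constantCoeff_gammaSaddle lam)) (m + 1)
  refine h.congr_deriv ?_
  have hJ := PowerSeries.mul_inv_cancel (gammaSaddle lam nu) (by simp [constantCoeff_gammaSaddle])
  have hc : (C lam⁻¹ : ℂ⟦X⟧) * C lam = 1 := by
    rw [← map_mul, inv_mul_cancel₀ hlam, map_one]
  have e : saddle lam (C lam * logTail) (PowerSeries.log ℂ * binom (nu - 1)) *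
      (gammaSaddle lam nu)⁻¹ = C lam⁻¹ * (X * (C (1 / 2 - nu) +
        X * d⁄dX ℂ (formalLog (gammaSaddle lam nu)))) := by
    rw [X_mul_derivative_formalLog]
    linear_combination C lam⁻¹ * (gammaSaddle lam nu)⁻¹ * C_mul_saddle_log_mul_binom hlam nu
      - saddle lam (C lam * logTail) (PowerSeries.log ℂ * binom (nu - 1)) *
        (gammaSaddle lam nu)⁻¹ * hc + C lam⁻¹ * X * C (1 / 2 - nu) * hJ
  change coeff (m + 1) (saddle lam (C lam * logTail) (PowerSeries.log ℂ * binom (nu - 1)) *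
      (gammaSaddle lam nu)⁻¹) = _
  rw [e, coeff_C_mul, coeff_succ_X_mul, map_add, coeff_X_mul_derivative]

theorem coeff_formalLog_one_sub (c : ℂ) (m : ℕ) :
    coeff (m + 1) (formalLog (1 - C c * X)) = -c ^ (m + 1) / (m + 1) := by
  have hi : (1 - C c * X : ℂ⟦X⟧)⁻¹ = PowerSeries.mk fun n => c ^ n := by
    rw [PowerSeries.inv_eq_iff_mul_eq_one (by simp)]
    ext n
    rw [mul_sub, mul_one, map_sub, mul_left_comm, coeff_C_mul, coeff_mk]
    cases n with
    | zero => simp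
    | succ n => rw [coeff_succ_mul_X, coeff_mk, coeff_one]; simp [pow_succ, mul_comm]
  have hd : d⁄dX ℂ (1 - C c * X) = -C c := by
    simp [Derivation.leibniz]
  rw [formalLog, coeff_mk, hi, hd, mul_assoc, coeff_succ_X_mul, neg_mul, map_neg, coeff_C_mul,
    coeff_mk]
  push_cast
  ring

theorem coeff_formalLog_gammaSaddle_add_one {lam : ℂ} (hlam : lam ≠ 0) (nu : ℂ) (m : ℕ) :
    coeff (m + 1) (formalLog (gammaSaddle lam (nu + 1))) =
      coeff (m + 1) (formalLog (gammaSaddle lam nu)) - (nu / lam) ^ (m + 1) / (m + 1) := by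
  rw [gammaSaddle_add_one hlam, formalLog_mul (by simp) (constantCoeff_gammaSaddle lam nu), map_add,
    coeff_formalLog_one_sub]
  ring

theorem aeval_bernoulli_add_one (n : ℕ) (x : ℂ) :
    Polynomial.aeval (x + 1) (Polynomial.bernoulli (n + 1)) =
      Polynomial.aeval x (Polynomial.bernoulli (n + 1)) + (n + 1) * x ^ n := by
  have h := congrArg (Polynomial.aeval x) (Polynomial.bernoulli_comp_one_add_X (n + 1))
  simp only [Polynomial.aeval_comp, map_add, map_one, Polynomial.aeval_X, nsmul_eq_mul, map_mul,
    map_natCast, map_pow, Nat.add_sub_cancel] at h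
  rw [add_comm x, h]
  push_cast
  ring

theorem hasDerivAt_aeval_bernoulli (n : ℕ) (x : ℂ) :
    HasDerivAt (fun w => Polynomial.aeval w (Polynomial.bernoulli (n + 1)))
      ((n + 1) * Polynomial.aeval x (Polynomial.bernoulli n)) x := by
  have h := Polynomial.hasDerivAt_aeval (Polynomial.bernoulli (n + 1)) x
  rw [Polynomial.derivative_bernoulli_add_one] at h
  simpa using h

theorem eq_zero_of_periodic_of_hasDerivAt_const {f : ℂ → ℂ} {k : ℂ} (hf : ∀ x, HasDerivAt f k x)
    (hp : ∀ x, f (x + 1) = f x) : k = 0 := by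
  have hd (x : ℂ) : HasDerivAt (fun w => f w - k * w) 0 x :=
    ((hf x).fun_sub ((hasDerivAt_id x).const_mul k)).congr_deriv (by simp)
  have h := is_const_of_deriv_eq_zero (fun x => (hd x).differentiableAt) (fun x => (hd x).deriv) 1 0
  have := hp 0
  rw [zero_add] at this
  simpa [this] using h

/-- Stirling's series. -/
theorem coeff_formalLog_gammaSaddle {lam : ℂ} (hlam : lam ≠ 0) (nu : ℂ) (m : ℕ) :
    coeff (m + 1) (formalLog (gammaSaddle lam nu)) =
      -(Polynomial.aeval nu (Polynomial.bernoulli (m + 2)) / ((m + 1) * (m + 2)) *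
        (1 / lam) ^ (m + 1)) := by
  -- The discrepancy `d m` is `1`-periodic in `ν`, and the derivative of `d (m + 1)` is a nonzero
  -- multiple of `d m`.
  set d : ℕ → ℂ → ℂ := fun m nu => coeff (m + 1) (formalLog (gammaSaddle lam nu)) +
    Polynomial.aeval nu (Polynomial.bernoulli (m + 2)) / ((m + 1) * (m + 2)) *
      (1 / lam) ^ (m + 1) with hd
  have hne (m : ℕ) : (m : ℂ) + 1 ≠ 0 := by exact_mod_cast m.succ_ne_zero
  have hne2 (m : ℕ) : (m : ℂ) + 2 ≠ 0 := by exact_mod_cast (m + 1).succ_ne_zero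
  have hper (m : ℕ) (x : ℂ) : d m (x + 1) = d m x := by
    simp only [hd, coeff_formalLog_gammaSaddle_add_one hlam, aeval_bernoulli_add_one (m + 1)]
    have := hne m
    have := hne2 m
    have h3 : ((m + 1 : ℕ) : ℂ) + 1 = m + 2 := by push_cast; ring
    rw [h3, div_pow, div_pow, one_pow]
    field_simp
    ring
  have hder0 (x : ℂ) : HasDerivAt (d 0) 0 x := by
    refine ((hasDerivAt_coeff_formalLog_gammaSaddle hlam x 0).fun_add
      (((hasDerivAt_aeval_bernoulli 1 x).div_const _).mul_const _)).congr_deriv ?_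
    simp [Polynomial.bernoulli_one]
    field_simp
    ring
  have hder (m : ℕ) (x : ℂ) : HasDerivAt (d (m + 1)) (lam⁻¹ * (m + 1) * d m x) x := by
    refine ((hasDerivAt_coeff_formalLog_gammaSaddle hlam x (m + 1)).fun_add
      (((hasDerivAt_aeval_bernoulli (m + 2) x).div_const _).mul_const _)).congr_deriv ?_
    have := hne m
    have := hne2 m
    have h3 := hne2 (m + 1)
    have h4 := hne (m + 1)
    have h5 := hne (m + 2)
    push_cast at h3 h4 h5 ⊢
    simp only [hd, coeff_C, Nat.add_eq_zero_iff, one_ne_zero, and_false, if_false, pow_succ]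
    field_simp
    ring
  -- If `d m` is constant, then `d (m + 1)` is periodic with constant derivative, hence constant
  -- too.
  have hconst (m : ℕ) (x : ℂ) : HasDerivAt (d m) 0 x := by
    induction m generalizing x with
    | zero => exact hder0 x
    | succ m ih =>
      have hc (y : ℂ) : d m y = d m 0 :=
        is_const_of_deriv_eq_zero (fun x => (ih x).differentiableAt) (fun x => (ih x).deriv) y 0
      have h (y : ℂ) : HasDerivAt (d (m + 1)) (lam⁻¹ * (m + 1) * d m 0) y := hc y ▸ hder m y
      exact eq_zero_of_periodic_of_hasDerivAt_const h (hper (m + 1)) ▸ h x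
  -- Constancy of `d (m + 1)` forces `d m = 0`, so no constant of integration remains.
  have h0 := (hder m nu).unique (hconst (m + 1) nu)
  have h1 : d m nu = 0 := by
    rcases mul_eq_zero.1 h0 with h | h
    · exact absurd h (mul_ne_zero (inv_ne_zero hlam) (hne m))
    · exact h
  exact eq_neg_of_add_eq_zero_left h1

/-! ### The common covering map and its wave function -/

/-- A covering map that specializes to those of the (1,4) curve and of the (2,3) curve. -/
noncomputable def coverX (p q lam r : ℂ) : ℂ → ℂ := fun z =>
  -3 * p * z ^ 2 - 2 * q * z + lam / z + r / z ^ 2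

/-- `- z ^ 2 x'(z)`, the second derivative of the phase at the saddle point. -/
noncomputable def hess (p q lam r : ℂ) : ℂ → ℂ := fun z =>
  6 * p * z ^ 3 + 2 * q * z ^ 2 + lam + 2 * r / z

/-- `1 / (1 + u) - 1 + u - u ^ 2`. -/
noncomputable def invTail : ℂ⟦X⟧ := -(X ^ 3 * (1 + X)⁻¹)

/-- The terms of degree at least three of the phase at the saddle point. -/
noncomputable def tail (p lam r : ℂ) : ℂ → ℂ⟦X⟧ := fun z =>
  C (p * z ^ 3) * X ^ 3 + C lam * logTail + C (r / z) * invTail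

theorem X_pow_three_dvd_tail (p lam r z : ℂ) : X ^ 3 ∣ tail p lam r z :=
  ((dvd_mul_left _ _).add (X_pow_three_dvd_logTail.mul_left _)).add
    ((dvd_neg.2 (dvd_mul_right _ _)).mul_left _)

theorem one_add_X_mul_derivative_invTail :
    (1 + X) * d⁄dX ℂ invTail = -3 * X ^ 2 - invTail := by
  have h : (1 + X) * invTail = -X ^ 3 := by
    have := PowerSeries.mul_inv_cancel (1 + X : ℂ⟦X⟧) (by simp)
    rw [invTail]
    linear_combination -X ^ 3 * this
  have h' := congrArg (d⁄dX ℂ) h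
  simp only [Derivation.leibniz, map_add, map_neg, derivative_one, derivative_X, derivative_pow,
    smul_eq_mul] at h'
  push_cast at h'
  linear_combination h'

section

variable {p q lam r z : ℂ}

theorem hasDerivAt_coverX (hz : z ≠ 0) :
    HasDerivAt (coverX p q lam r) (-(hess p q lam r z / z ^ 2)) z := by
  have h := ((((hasDerivAt_pow 2 z).const_mul (-3 * p)).sub
    ((hasDerivAt_id z).const_mul (2 * q))).add ((hasDerivAt_inv hz).const_mul lam)).add
    (((hasDerivAt_pow 2 z).inv (pow_ne_zero 2 hz)).const_mul r)
  refine (h.congr_deriv ?_).congr_of_eventuallyEq (Eventually.of_forall fun w => ?_)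
  · simp only [hess]
    field_simp
    ring
  · simp [coverX, div_eq_mul_inv]

/-- Half of the derivative of `hess`. -/
noncomputable def hessDeriv (p q r z : ℂ) : ℂ := 9 * p * z ^ 2 + 2 * q * z - r / z ^ 2

theorem hasDerivAt_hess (hz : z ≠ 0) :
    HasDerivAt (hess p q lam r) (2 * hessDeriv p q r z) z := by
  have h := ((((hasDerivAt_pow 3 z).const_mul (6 * p)).add
    ((hasDerivAt_pow 2 z).const_mul (2 * q))).add (hasDerivAt_const z lam)).add
    ((hasDerivAt_inv hz).const_mul (2 * r))
  refine (h.congr_deriv ?_).congr_of_eventuallyEq (Eventually.of_forall fun w => ?_)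
  · simp only [hessDeriv]
    field_simp
    ring
  · simp [hess, div_eq_mul_inv]

/-- The derivative of `tail`. -/
noncomputable def tailDeriv (p r z : ℂ) : ℂ⟦X⟧ :=
  C (3 * p * z ^ 2) * X ^ 3 - C (r / z ^ 2) * invTail

theorem hasCoeffDerivAt_tail (hz : z ≠ 0) :
    HasCoeffDerivAt (tail p lam r) (tailDeriv p r z) z := by
  have h1 : HasDerivAt (fun z => p * z ^ 3) (3 * p * z ^ 2) z :=
    ((hasDerivAt_pow 3 z).const_mul p).congr_deriv (by push_cast; ring)
  have h2 : HasDerivAt (fun z => r / z) (-(r / z ^ 2)) z :=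
    ((hasDerivAt_inv hz).const_mul r).congr_deriv (by field_simp)
  refine (((HasCoeffDerivAt.C h1).mul (HasCoeffDerivAt.const (X ^ 3) z)).add
    (HasCoeffDerivAt.const (C lam * logTail) z)).add
    ((HasCoeffDerivAt.C h2).mul (HasCoeffDerivAt.const invTail z)) |>.congr_deriv ?_
  simp only [tailDeriv, map_neg]
  ring

/-- The phase depends on `z` only through the saddle point, up to its linear part. -/
theorem phase_identity (hz : z ≠ 0) :
    C z * (C (hessDeriv p q r z) * X ^ 2 + tailDeriv p r z) =
      -(C (hess p q lam r z) * X) +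
        (C (hess p q lam r z) * X + d⁄dX ℂ (tail p lam r z)) * (1 + X) := by
  have hd : d⁄dX ℂ (tail p lam r z) = 3 * C (p * z ^ 3) * X ^ 2 + C lam * d⁄dX ℂ logTail
      + C (r / z) * d⁄dX ℂ invTail := by
    simp only [tail, map_add, Derivation.leibniz, derivative_C, derivative_pow, derivative_X,
      smul_eq_mul]
    push_cast
    ring
  have h1 : C z * C (hessDeriv p q r z) = 9 * C (p * z ^ 3) + 2 * C (q * z ^ 2) - C (r / z) := by
    rw [show (9 : ℂ⟦X⟧) = C 9 from rfl, show (2 : ℂ⟦X⟧) = C 2 from rfl]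
    simp only [← map_mul, ← map_add, ← map_sub]
    congr 1
    simp only [hessDeriv]
    field_simp
  have h2 : C (hess p q lam r z) =
      6 * C (p * z ^ 3) + 2 * C (q * z ^ 2) + C lam + 2 * C (r / z) := by
    rw [show (6 : ℂ⟦X⟧) = C 6 from rfl, show (2 : ℂ⟦X⟧) = C 2 from rfl]
    simp only [← map_mul, ← map_add]
    congr 1
    simp only [hess]
    ring
  have h3 : C z * tailDeriv p r z = 3 * C (p * z ^ 3) * X ^ 3 - C (r / z) * invTail := by
    rw [show (3 : ℂ⟦X⟧) = C 3 from rfl, tailDeriv, mul_sub]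
    simp only [← map_mul, ← mul_assoc]
    rw [show z * 3 * p * z ^ 2 = 3 * p * z ^ 3 by ring,
      show z * (r / z ^ 2) = r / z by field_simp]
  rw [hd]
  linear_combination X ^ 2 * h1 - X ^ 2 * h2 + h3 - C lam * one_add_X_mul_derivative_logTail
    - C (r / z) * one_add_X_mul_derivative_invTail

theorem mem_regularLocus_coverX (h : lam ≠ 0 ∨ r ≠ 0) :
    z ∈ regularLocus (coverX p q lam r) ↔ z ≠ 0 ∧ hess p q lam r z ≠ 0 := by
  have key (hz : z ≠ 0) : deriv (coverX p q lam r) z ≠ 0 ↔ hess p q lam r z ≠ 0 := by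
    rw [(hasDerivAt_coverX hz).deriv]
    simp [hz]
  have hz0 (ha : AnalyticAt ℂ (coverX p q lam r) z) : z ≠ 0 := by
    rintro rfl
    have hc : Tendsto (coverX p q lam r) (𝓝[≠] 0) (𝓝 (coverX p q lam r 0)) :=
      ha.continuousAt.tendsto.mono_left nhdsWithin_le_nhds
    have hid : Tendsto (fun w : ℂ => w) (𝓝[≠] 0) (𝓝 0) :=
      tendsto_id.mono_left nhdsWithin_le_nhds
    have hp (f : ℂ → ℂ) (hf : Continuous f) : Tendsto f (𝓝[≠] 0) (𝓝 (f 0)) :=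
      (hf.tendsto 0).mono_left nhdsWithin_le_nhds
    -- Division by zero gives `coverX` a finite value at `0`, so analyticity there must be refuted:
    -- the limits of `w² x(w)` and then of `w x(w)` would force `r = 0` and `λ = 0`.
    have hr : r = 0 := by
      have h1 := (hid.pow 2).mul hc
      have h2 := hp (fun w => -3 * p * w ^ 4 - 2 * q * w ^ 3 + lam * w + r) (by fun_prop)
      have h3 := tendsto_nhds_unique (h1.congr' ?_) h2
      · simpa using h3.symm
      · filter_upwards [self_mem_nhdsWithin] with w (hw : w ≠ 0)
        simp only [coverX]
        field_simp
    have hl : lam = 0 := by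
      have h1 := hid.mul hc
      have h2 := hp (fun w => -3 * p * w ^ 3 - 2 * q * w ^ 2 + lam) (by fun_prop)
      have h3 := tendsto_nhds_unique (h1.congr' ?_) h2
      · simpa using h3.symm
      · filter_upwards [self_mem_nhdsWithin] with w (hw : w ≠ 0)
        simp only [coverX, hr]
        field_simp
        ring
    exact h.elim (· hl) (· hr)
  constructor
  · rintro ⟨ha, hd⟩
    exact ⟨hz0 ha, (key (hz0 ha)).1 hd⟩
  · rintro ⟨hz, hA⟩
    refine ⟨?_, (key hz).2 hA⟩
    unfold coverX
    fun_prop (disch := simp [hz])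

theorem isOpen_regularLocus_coverX (h : lam ≠ 0 ∨ r ≠ 0) :
    IsOpen (regularLocus (coverX p q lam r)) := by
  rw [isOpen_iff_mem_nhds]
  intro z hz
  have h0 := (mem_regularLocus_coverX h).1 hz
  filter_upwards [isOpen_ne.mem_nhds h0.1,
    (hasDerivAt_hess h0.1).continuousAt.eventually_ne h0.2] with w h1 h2
  exact (mem_regularLocus_coverX h).2 ⟨h1, h2⟩

/-- The saddle point expansion of `∫ ξ ^ (ν - 1 + j) exp (ħ⁻¹ (x ξ + ⋯)) dξ`, the `j`-th
`ħ`-derivative of the wave function, divided by the leading factor of the wave function. -/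
noncomputable def psi (p q lam r nu : ℂ) (j : ℕ) : ℂ → ℂ⟦X⟧ := fun z =>
  C (z ^ j) * saddle (hess p q lam r z) (tail p lam r z) (binom (nu - 1 + j))

/-- The part of `ħ S` that comes from the leading factor of the wave function. -/
noncomputable def leadingPart (p q lam r nu z : ℂ) : ℂ⟦X⟧ :=
  C z - X * C (z / hess p q lam r z * (nu - z * hessDeriv p q r z / hess p q lam r z))

theorem saddle_X_mul_binom (A : ℂ) (R : ℂ⟦X⟧) (s : ℂ) :
    saddle A R (X * binom s) = saddle A R (binom (s + 1)) - saddle A R (binom s) := by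
  rw [binom_add_one, add_mul, one_mul, saddle_add]
  ring

/-- Under the integral sign `ħ d/dx` multiplies by `ξ`, which takes `j` to `j + 1`. Dividing out the
leading factor subtracts its logarithmic derivative `leadingPart`. -/
theorem exists_hasCoeffDerivAt_psi (hz : z ≠ 0) (hA : hess p q lam r z ≠ 0) (nu : ℂ) (j : ℕ) :
    ∃ D, HasCoeffDerivAt (psi p q lam r nu j) D z ∧
      X * (C (deriv (coverX p q lam r) z)⁻¹ * D) =
        psi p q lam r nu (j + 1) z - leadingPart p q lam r nu z * psi p q lam r nu j z := by
  set A := hess p q lam r z with hAdef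
  set R := tail p lam r z with hRdef
  set s : ℂ := nu - 1 + j with hs
  set H := hessDeriv p q r z with hH
  set P := saddle A R (binom s * (C H * X ^ 2 + tailDeriv p r z)) with hP
  have h0 : saddle A R 0 = 0 := by simpa using saddle_C_mul A R 0 0
  set D : ℂ⟦X⟧ := (PowerSeries.mk fun m => coeff (m + 1) P) + C (H / A) * saddle A R (binom s)
    with hD
  have hder : HasCoeffDerivAt
      (fun w => saddle (hess p q lam r w) (tail p lam r w) (binom s)) D z := fun m => by
    refine (hasCoeffDerivAt_saddle (hasDerivAt_hess hz) hA (hasCoeffDerivAt_tail hz)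
      (HasCoeffDerivAt.const (binom s) z) (X_pow_three_dvd_tail p lam r) m).congr_deriv ?_
    have e1 : 2 * hessDeriv p q r z / 2 = H := by simp [H]
    have e2 : 2 * hessDeriv p q r z / (2 * hess p q lam r z) = H / A := by
      rw [mul_div_mul_left _ _ two_ne_zero]
    rw [e1, e2, ← hAdef, ← hRdef, h0, map_zero, zero_add, hD, map_add, coeff_mk, coeff_C_mul]
  have hXD : X * D = P + X * C (H / A) * saddle A R (binom s) := by
    have hP0 : X * (PowerSeries.mk fun m => coeff (m + 1) P) = P := by
      ext m
      cases m with
      | zero =>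
        -- The amplitude in `P` starts at `u²`, so `P` has no constant term and is divisible by `ħ`.
        have : X ^ 3 ∣ tailDeriv p r z := (dvd_mul_left _ _).sub
          ((dvd_neg.2 (dvd_mul_right _ _)).mul_left _)
        obtain ⟨T, hT⟩ := this
        simp [hP, constantCoeff_saddle, hT]
      | succ m => rw [coeff_succ_X_mul, coeff_mk]
    rw [hD, mul_add, hP0]
    ring
  have hzP : C z * P = -(C A * (saddle A R (binom (s + 1)) - saddle A R (binom s))) -
      X * C (s + 1) * saddle A R (binom s) := by
    have hibp := saddle_integration_by_parts hA (X_pow_three_dvd_tail p lam r z)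
      ((1 + X) * binom s)
    rw [derivative_one_add_X_mul_binom, saddle_C_mul] at hibp
    -- By `phase_identity`, `z d/dz` of the phase becomes `(1 + u) d/du` up to a linear term, which
    -- integration by parts removes.
    have e : C z * (binom s * (C H * X ^ 2 + tailDeriv p r z)) =
        -(C A * (X * binom s)) + (C A * X + d⁄dX ℂ R) * ((1 + X) * binom s) := by
      linear_combination binom s * phase_identity (lam := lam) hz
    rw [hP, ← saddle_C_mul, e, saddle_add, saddle_neg, saddle_C_mul, hibp, saddle_X_mul_binom]
    ring
  have hpow : HasDerivAt (fun w : ℂ => w ^ j) (j * z ^ (j - 1)) z := hasDerivAt_pow j z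
  refine ⟨_, (HasCoeffDerivAt.C hpow).mul hder, ?_⟩
  rw [(hasDerivAt_coverX hz).deriv]
  have hj : (j : ℂ) * z ^ (j - 1) = j * z ^ j / z := by
    rcases j with _ | j
    · simp
    · rw [Nat.add_sub_cancel, pow_succ]
      field_simp
  have hs1 : nu - 1 + (j + 1 : ℕ) = s + 1 := by rw [hs]; push_cast; ring
  simp only [psi, leadingPart, hs1, ← hs, ← hAdef, ← hRdef, ← hH, hj]
  have c1 : C (-(A / z ^ 2))⁻¹ = -(C A⁻¹ * C z ^ 2) := by
    rw [← map_pow, ← map_mul, ← map_neg]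
    congr 1
    field_simp
  have c2 : C (j * z ^ j / z) * C z = C (z ^ j) * C (j : ℂ) := by
    rw [← map_mul, ← map_mul]
    congr 1
    field_simp
  have c3 : C A * C A⁻¹ = (1 : ℂ⟦X⟧) := by rw [← map_mul, mul_inv_cancel₀ hA, map_one]
  have c4 : C (H / A) = C H * C A⁻¹ := by rw [div_eq_mul_inv, map_mul]
  have c5 : C (z / A * (nu - z * H / A)) = C z * C A⁻¹ * (C nu - C z * C H * C A⁻¹) := by
    simp only [div_eq_mul_inv, map_mul, map_sub]
  have c6 : (C (s + 1) : ℂ⟦X⟧) = C nu + C (j : ℂ) := by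
    rw [← map_add, hs]
    congr 1
    ring
  have c7 : (C (z ^ (j + 1)) : ℂ⟦X⟧) = C (z ^ j) * C z := by rw [← map_mul, pow_succ]
  rw [c4] at hXD
  rw [c6] at hzP
  rw [c1, c5, c7]
  linear_combination (-(C A⁻¹ * C z ^ 2) * C (z ^ j)) * hXD
    - (C A⁻¹ * C z * C (z ^ j)) * hzP
    - X * C A⁻¹ * C z * saddle A R (binom s) * c2
    + C z * C (z ^ j) * (saddle A R (binom (s + 1)) - saddle A R (binom s)) * c3

end

/-! ### The derivation `ħ d/dx` and uniqueness of the WKB solution -/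

/-- `f` is differentiable at `z` coefficientwise and `ħ d/dx f = E` there. -/
def HasHbarDerivAt (x : ℂ → ℂ) (f : ℂ → ℂ⟦X⟧) (E : ℂ⟦X⟧) (z : ℂ) : Prop :=
  ∃ D, HasCoeffDerivAt f D z ∧ X * (C (deriv x z)⁻¹ * D) = E

namespace HasHbarDerivAt

variable {x : ℂ → ℂ} {f g : ℂ → ℂ⟦X⟧} {E E' : ℂ⟦X⟧} {z : ℂ}

theorem hbarD_eq (h : HasHbarDerivAt x f E z) : hbarD x f z = E := by
  obtain ⟨D, hD, rfl⟩ := h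
  rw [hbarD]
  congr 1
  ext m
  rw [coeff_mk, coeff_C_mul, (hD m).deriv, div_eq_inv_mul]

theorem sub (hf : HasHbarDerivAt x f E z) (hg : HasHbarDerivAt x g E' z) :
    HasHbarDerivAt x (fun w => f w - g w) (E - E') z := by
  obtain ⟨D, hD, rfl⟩ := hf
  obtain ⟨D', hD', rfl⟩ := hg
  exact ⟨_, hD.sub hD', by ring⟩

theorem mul (hf : HasHbarDerivAt x f E z) (hg : HasHbarDerivAt x g E' z) :
    HasHbarDerivAt x (fun w => f w * g w) (E * g z + f z * E') z := by
  obtain ⟨D, hD, rfl⟩ := hf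
  obtain ⟨D', hD', rfl⟩ := hg
  exact ⟨_, hD.mul hD', by ring⟩

theorem inv (hf : HasHbarDerivAt x f E z) (h1 : ∀ w, constantCoeff (f w) = 1) :
    HasHbarDerivAt x (fun w => (f w)⁻¹) (-(E * (f z)⁻¹ * (f z)⁻¹)) z := by
  obtain ⟨D, hD, rfl⟩ := hf
  exact ⟨_, hD.inv h1, by ring⟩

end HasHbarDerivAt

theorem hbarD_congr {x : ℂ → ℂ} {f g : ℂ → ℂ⟦X⟧} {z : ℂ} (h : f =ᶠ[𝓝 z] g) :
    hbarD x f z = hbarD x g z := by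
  simp only [hbarD]
  congr 2
  ext m
  congr 1
  exact EventuallyEq.deriv_eq (h.mono fun w hw => congrArg (coeff m) hw)

theorem coeff_succ_hbarD (x : ℂ → ℂ) (f : ℂ → ℂ⟦X⟧) (z : ℂ) (n : ℕ) :
    coeff (n + 1) (hbarD x f z) = deriv (fun w => coeff n (f w)) z / deriv x z := by
  rw [hbarD, coeff_succ_X_mul, coeff_mk]

theorem constantCoeff_hbarD (x : ℂ → ℂ) (f : ℂ → ℂ⟦X⟧) (z : ℂ) :
    constantCoeff (hbarD x f z) = 0 := by
  simp [hbarD]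

/-- If two families agree modulo `ħ ^ n` on an open set, their `ħ`-derivatives agree modulo
`ħ ^ (n + 1)`. -/
theorem X_pow_succ_dvd_hbarD_sub {x : ℂ → ℂ} {f g : ℂ → ℂ⟦X⟧} {U : Set ℂ} (hU : IsOpen U) {n : ℕ}
    (h : ∀ z ∈ U, X ^ n ∣ f z - g z) {z : ℂ} (hz : z ∈ U) :
    X ^ (n + 1) ∣ hbarD x f z - hbarD x g z := by
  rw [X_pow_dvd_iff]
  intro m hm
  rw [map_sub, sub_eq_zero]
  cases m with
  | zero => simp [constantCoeff_hbarD]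
  | succ m =>
    rw [coeff_succ_hbarD, coeff_succ_hbarD]
    congr 1
    refine EventuallyEq.deriv_eq ?_
    filter_upwards [hU.mem_nhds hz] with w hw
    have := X_pow_dvd_iff.1 (h w hw) m (by lia)
    rwa [map_sub, sub_eq_zero] at this

/-- The WKB solution with given leading term is unique. -/
theorem IsWKB.eq_of_isWKB {p : Fin 4 → ℂ → ℂ⟦X⟧} {x y : ℂ → ℂ} {σ σ' : ℂ → ℂ⟦X⟧}
    (hU : IsOpen (regularLocus x))
    (hp : ∀ z ∈ regularLocus x, 3 * constantCoeff (p 0 (x z)) * y z ^ 2 +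
      2 * constantCoeff (p 1 (x z)) * y z + constantCoeff (p 2 (x z)) ≠ 0)
    (h : IsWKB p x y σ) (h' : IsWKB p x y σ') {z : ℂ} (hz : z ∈ regularLocus x) :
    σ z = σ' z := by
  have key (n : ℕ) : ∀ z ∈ regularLocus x, X ^ (n + 1) ∣ σ z - σ' z := by
    induction n with
    | zero =>
      intro z hz
      have h1 := h.leading z hz
      have h2 := h'.leading z hz
      rw [zero_add, pow_one, X_dvd_iff, map_sub, ← coeff_zero_eq_constantCoeff_apply,
        ← coeff_zero_eq_constantCoeff_apply, h1, h2, sub_self]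
    | succ n ih =>
      intro z hz
      obtain ⟨a, ha⟩ := ih z hz
      obtain ⟨b, hb⟩ := X_pow_succ_dvd_hbarD_sub (x := x) hU ih hz
      obtain ⟨c, hc⟩ := X_pow_succ_dvd_hbarD_sub (x := x) hU
        (fun w hw => X_pow_succ_dvd_hbarD_sub (x := x) hU ih hw) hz
      have hH : X ∣ hbarD x σ z := X_dvd_iff.2 (constantCoeff_hbarD x σ z)
      obtain ⟨d, hd⟩ := hH
      have e := h.riccati z hz
      have e' := h'.riccati z hz
      rw [RiccatiAt] at e e'
      -- Two solutions differ by `ħ ^ (n + 1) a`, and each `ħ`-derivative gains one order. At lowest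
      -- order `a` is thus multiplied by the `y`-derivative of the classical curve, which `hp` keeps
      -- nonzero.
      have hs : X ^ (n + 1) * (a * (p 0 (x z) * (σ z ^ 2 + σ z * σ' z + σ' z ^ 2) +
          p 1 (x z) * (σ z + σ' z) + p 2 (x z)) +
          X * (p 0 (x z) * (X * c + 3 * d * a + 3 * σ' z * b) + p 1 (x z) * b)) = 0 := by
        linear_combination e - e' - p 0 (x z) * hc - 3 * p 0 (x z) * hbarD x σ z * ha
          - 3 * p 0 (x z) * σ' z * hb - p 1 (x z) * hb
          - (p 0 (x z) * (σ z ^ 2 + σ z * σ' z + σ' z ^ 2) +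
            p 1 (x z) * (σ z + σ' z) + p 2 (x z)) * ha
          - 3 * p 0 (x z) * X ^ (n + 1) * a * hd
      have h0 := (mul_eq_zero.1 hs).resolve_left (pow_ne_zero _ X_ne_zero)
      have h1 := congrArg constantCoeff h0
      have hy := h.leading z hz
      have hy' := h'.leading z hz
      rw [coeff_zero_eq_constantCoeff_apply] at hy hy'
      simp only [map_add, map_mul, map_pow, hy, hy', constantCoeff_X, zero_mul, add_zero,
        map_zero] at h1
      have ha0 : constantCoeff a = 0 := by
        refine (mul_eq_zero.1 h1).resolve_right fun h2 => hp z hz ?_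
        linear_combination h2
      obtain ⟨a', rfl⟩ := X_dvd_iff.2 ha0
      exact ⟨a', by rw [ha]; ring⟩
  ext n
  have := X_pow_dvd_iff.1 (key n z hz) n (by lia)
  rwa [map_sub, sub_eq_zero] at this

/-! ### The WKB solution from the wave function, and its primitive -/

section

variable {p q lam r nu : ℂ}

theorem constantCoeff_psi_zero (z : ℂ) : constantCoeff (psi p q lam r nu 0 z) = 1 := by
  simp [psi, constantCoeff_saddle, constantCoeff_binom]

/-- `ħ ^ j ψ⁽ʲ⁾ / ψ`. -/
noncomputable def ratio (p q lam r nu : ℂ) (j : ℕ) : ℂ → ℂ⟦X⟧ := fun z =>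
  psi p q lam r nu j z * (psi p q lam r nu 0 z)⁻¹

theorem hasHbarDerivAt_ratio (h : lam ≠ 0 ∨ r ≠ 0) (j : ℕ) {z : ℂ}
    (hz : z ∈ regularLocus (coverX p q lam r)) :
    HasHbarDerivAt (coverX p q lam r) (ratio p q lam r nu j)
      (ratio p q lam r nu (j + 1) z - ratio p q lam r nu j z * ratio p q lam r nu 1 z) z := by
  obtain ⟨hz0, hA⟩ := (mem_regularLocus_coverX h).1 hz
  have hj : HasHbarDerivAt (coverX p q lam r) (psi p q lam r nu j) _ z :=
    ⟨_, (exists_hasCoeffDerivAt_psi hz0 hA nu j).choose_spec.1,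
      (exists_hasCoeffDerivAt_psi hz0 hA nu j).choose_spec.2⟩
  have h0 : HasHbarDerivAt (coverX p q lam r) (psi p q lam r nu 0) _ z :=
    ⟨_, (exists_hasCoeffDerivAt_psi hz0 hA nu 0).choose_spec.1,
      (exists_hasCoeffDerivAt_psi hz0 hA nu 0).choose_spec.2⟩
  obtain ⟨D, hD, e⟩ := hj.mul (h0.inv constantCoeff_psi_zero)
  refine ⟨D, hD, e.trans ?_⟩
  have hi := PowerSeries.mul_inv_cancel (psi p q lam r nu 0 z) (by simp [constantCoeff_psi_zero])
  simp only [ratio, zero_add]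
  linear_combination leadingPart p q lam r nu z * psi p q lam r nu j z *
    (psi p q lam r nu 0 z)⁻¹ * hi

/-- Since `ħ d/dx` sends `ratio 1` to `ratio 2 - ratio 1 ^ 2`, and similarly one order higher, the
Riccati expression collapses to the linear equation `hP` divided by `psi 0`. -/
theorem isWKB_ratio {P : Fin 4 → ℂ → ℂ⟦X⟧} (h : lam ≠ 0 ∨ r ≠ 0)
    (hP : ∀ z ∈ regularLocus (coverX p q lam r),
      P 0 (coverX p q lam r z) * psi p q lam r nu 3 z + P 1 (coverX p q lam r z) *
        psi p q lam r nu 2 z + P 2 (coverX p q lam r z) * psi p q lam r nu 1 z +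
        P 3 (coverX p q lam r z) * psi p q lam r nu 0 z = 0) :
    IsWKB P (coverX p q lam r) (fun z => z) (ratio p q lam r nu 1) where
  holo m z hz := by
    obtain ⟨D, hD, -⟩ := hasHbarDerivAt_ratio (nu := nu) h 1 hz
    exact (hD m).differentiableAt.differentiableWithinAt
  leading z _ := by
    simp [ratio, psi, constantCoeff_saddle, constantCoeff_binom]
  riccati z hz := by
    have h1 := (hasHbarDerivAt_ratio (nu := nu) h 1 hz)
    have h2 := (hasHbarDerivAt_ratio (nu := nu) h 2 hz)
    have e : hbarD (coverX p q lam r) (ratio p q lam r nu 1) =ᶠ[𝓝 z]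
        fun w => ratio p q lam r nu 2 w - ratio p q lam r nu 1 w * ratio p q lam r nu 1 w := by
      filter_upwards [(isOpen_regularLocus_coverX h).mem_nhds hz] with w hw
      exact (hasHbarDerivAt_ratio h 1 hw).hbarD_eq
    rw [RiccatiAt, hbarD_congr e, (h2.sub (h1.mul h1)).hbarD_eq, h1.hbarD_eq]
    have hi := PowerSeries.mul_inv_cancel (psi p q lam r nu 0 z) (by simp [constantCoeff_psi_zero])
    have h3 := hP z hz
    simp only [ratio, Nat.reduceAdd]
    linear_combination (psi p q lam r nu 0 z)⁻¹ * h3 - P 3 (coverX p q lam r z) * hi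

/-- The logarithm of the normalized wave function is a primitive of `S_m dx`. -/
theorem hasDerivAt_coeff_formalLog_psi (h : lam ≠ 0 ∨ r ≠ 0) {z : ℂ}
    (hz : z ∈ regularLocus (coverX p q lam r)) {m : ℕ} (hm : 1 ≤ m) :
    HasDerivAt (fun w => coeff m (formalLog (psi p q lam r nu 0 w)))
      (coeff (m + 1) (ratio p q lam r nu 1 z) * deriv (coverX p q lam r) z) z := by
  obtain ⟨hz0, hA⟩ := (mem_regularLocus_coverX h).1 hz
  obtain ⟨D, hD, e⟩ := exists_hasCoeffDerivAt_psi hz0 hA nu 0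
  refine (hD.formalLog constantCoeff_psi_zero m).congr_deriv ?_
  have hi := PowerSeries.mul_inv_cancel (psi p q lam r nu 0 z) (by simp [constantCoeff_psi_zero])
  have hr : ratio p q lam r nu 1 z = leadingPart p q lam r nu z +
      X * (C (deriv (coverX p q lam r) z)⁻¹ * (D * (psi p q lam r nu 0 z)⁻¹)) := by
    rw [zero_add] at e
    rw [ratio]
    linear_combination -(psi p q lam r nu 0 z)⁻¹ * e + leadingPart p q lam r nu z * hi
  -- `leadingPart` has only the orders `ħ⁰` and `ħ¹`, that is `S₋₁` and part of `S₀`; hence the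
  -- condition `1 ≤ m`.
  have hl : coeff (m + 1) (leadingPart p q lam r nu z) = 0 := by
    rw [leadingPart, map_sub, coeff_succ_X_mul, coeff_C, coeff_C, if_neg (by lia), if_neg (by lia),
      sub_zero]
  rw [hr, map_add, hl, zero_add, coeff_succ_X_mul, coeff_C_mul]
  have := hz.2
  field_simp

theorem inv_one_add_X_mul_binom (s : ℂ) : (1 + X)⁻¹ * binom (s + 1) = binom s := by
  rw [binom_add_one, ← mul_assoc, PowerSeries.inv_mul_cancel _ (by simp), one_mul]

/-- The differential equation in terms of saddle point expansions. -/
theorem saddle_recurrence {z : ℂ} (hz : z ≠ 0) (hA : hess p q lam r z ≠ 0) (s : ℂ) :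
    C (3 * p * z ^ 3) * saddle (hess p q lam r z) (tail p lam r z) (binom (s + 3)) +
      C (2 * q * z ^ 2) * saddle (hess p q lam r z) (tail p lam r z) (binom (s + 2)) +
      C (z * coverX p q lam r z) * saddle (hess p q lam r z) (tail p lam r z) (binom (s + 1)) -
      C (lam) * saddle (hess p q lam r z) (tail p lam r z) (binom s) -
      C (r / z) * saddle (hess p q lam r z) (tail p lam r z) (binom (s - 1)) +
      X * (C (s + 1) * saddle (hess p q lam r z) (tail p lam r z) (binom s)) = 0 := by
  have h := saddle_integration_by_parts hA (X_pow_three_dvd_tail p lam r z) ((1 + X) * binom s)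
  rw [derivative_one_add_X_mul_binom, saddle_C_mul] at h
  have hd : d⁄dX ℂ (tail p lam r z) = 3 * C (p * z ^ 3) * X ^ 2 + C lam * d⁄dX ℂ logTail
      + C (r / z) * d⁄dX ℂ invTail := by
    simp only [tail, map_add, Derivation.leibniz, derivative_C, derivative_pow, derivative_X,
      smul_eq_mul]
    push_cast
    ring
  have h1 : (C (z * coverX p q lam r z) : ℂ⟦X⟧) =
      -3 * C (p * z ^ 3) - 2 * C (q * z ^ 2) + C lam + C (r / z) := by
    rw [show (3 : ℂ⟦X⟧) = C 3 from rfl, show (2 : ℂ⟦X⟧) = C 2 from rfl]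
    simp only [← map_mul, ← map_add, ← map_sub, ← map_neg]
    congr 1
    simp only [coverX]
    field_simp
  have h2 : C (hess p q lam r z) =
      6 * C (p * z ^ 3) + 2 * C (q * z ^ 2) + C lam + 2 * C (r / z) := by
    rw [show (6 : ℂ⟦X⟧) = C 6 from rfl, show (2 : ℂ⟦X⟧) = C 2 from rfl]
    simp only [← map_mul, ← map_add]
    congr 1
    simp only [hess]
    ring
  have h3 : (C (3 * p * z ^ 3) : ℂ⟦X⟧) = 3 * C (p * z ^ 3) := by
    rw [show (3 : ℂ⟦X⟧) = C 3 from rfl, ← map_mul, mul_assoc]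
  have h4 : (C (2 * q * z ^ 2) : ℂ⟦X⟧) = 2 * C (q * z ^ 2) := by
    rw [show (2 : ℂ⟦X⟧) = C 2 from rfl, ← map_mul, mul_assoc]
  have b1 := binom_add_one s
  have b2 := binom_add_one (s + 1)
  have b3 := binom_add_one (s + 2)
  rw [show s + 1 + 1 = s + 2 by ring] at b2
  rw [show s + 2 + 1 = s + 3 by ring] at b3
  have b0 := inv_one_add_X_mul_binom (s - 1)
  rw [sub_add_cancel] at b0
  have hi := PowerSeries.mul_inv_cancel (1 + X : ℂ⟦X⟧) (by simp)
  have hK : invTail = -(X ^ 3 * (1 + X)⁻¹) := rfl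
  -- This is `ξ φ'(ξ) ξ^s` expanded in powers of `ξ = z (1 + u)`, up to a power of `z`.
  have e : (C (hess p q lam r z) * X + d⁄dX ℂ (tail p lam r z)) * ((1 + X) * binom s) =
      C (3 * p * z ^ 3) * binom (s + 3) + C (2 * q * z ^ 2) * binom (s + 2) +
      C (z * coverX p q lam r z) * binom (s + 1) + C (-lam) * binom s +
      C (-(r / z)) * binom (s - 1) := by
    rw [h1, h2, h3, h4, hd, b3, b2, b1, ← b0, map_neg, map_neg]
    linear_combination C lam * binom s * one_add_X_mul_derivative_logTail +
      C (r / z) * binom s * one_add_X_mul_derivative_invTail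
      - C (r / z) * binom s * hK + C (r / z) * binom s * (X ^ 2 - X + 1) * hi
  rw [e] at h
  simp only [saddle_add, saddle_C_mul] at h
  rw [map_neg, map_neg] at h
  linear_combination h

end

/-! ### Path integrals and existence of paths -/

/-- The integral of an exact differential along a path from `0` to `∞`. -/
theorem tendsto_integral_of_hasDerivAt {x F g : ℂ → ℂ} {γ : ℝ → ℂ} {a b : ℂ}
    (hU : IsOpen (regularLocus x)) (hγ : IsVorosPath x γ)
    (hF : ∀ z ∈ regularLocus x, HasDerivAt F (g z) z)
    (h0 : Tendsto F (𝓝[regularLocus x] 0) (𝓝 a))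
    (h1 : Tendsto F (Bornology.cobounded ℂ ⊓ 𝓟 (regularLocus x)) (𝓝 b)) :
    Tendsto (fun st : ℝ × ℝ => ∫ s in st.1..st.2, g (γ s) * deriv γ s)
      ((𝓝[>] 0) ×ˢ (𝓝[<] 1)) (𝓝 (b - a)) := by
  have hI0 : ∀ᶠ s in 𝓝[>] (0 : ℝ), s ∈ Set.Ioo (0 : ℝ) 1 := Ioo_mem_nhdsGT one_pos
  have hI1 : ∀ᶠ s in 𝓝[<] (1 : ℝ), s ∈ Set.Ioo (0 : ℝ) 1 := Ioo_mem_nhdsLT one_pos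
  have hg : ContinuousOn g (regularLocus x) := by
    have hd : DifferentiableOn ℂ F (regularLocus x) := fun z hz =>
      (hF z hz).differentiableAt.differentiableWithinAt
    exact (hd.deriv hU).continuousOn.congr fun z hz => (hF z hz).deriv.symm
  have hγd (s : ℝ) (hs : s ∈ Set.Ioo (0 : ℝ) 1) : HasDerivAt γ (deriv γ s) s :=
    ((hγ.smooth.differentiableOn one_ne_zero s hs).differentiableAt
      (isOpen_Ioo.mem_nhds hs)).hasDerivAt
  have hγ' : ContinuousOn (deriv γ) (Set.Ioo 0 1) :=
    hγ.smooth.continuousOn_deriv_of_isOpen isOpen_Ioo le_rfl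
  have hcont : ContinuousOn (fun s => g (γ s) * deriv γ s) (Set.Ioo 0 1) :=
    (hg.comp hγ.smooth.continuousOn hγ.mem).mul hγ'
  have hint : ∀ᶠ st : ℝ × ℝ in (𝓝[>] 0) ×ˢ (𝓝[<] 1),
      F (γ st.2) - F (γ st.1) = ∫ s in st.1..st.2, g (γ s) * deriv γ s := by
    filter_upwards [hI0.prod_mk hI1] with st hst
    have hsub : Set.uIcc st.1 st.2 ⊆ Set.Ioo (0 : ℝ) 1 :=
      Set.OrdConnected.uIcc_subset Set.ordConnected_Ioo hst.1 hst.2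
    rw [intervalIntegral.integral_eq_sub_of_hasDerivAt (f := fun s => F (γ s))]
    · intro s hs
      exact (hF _ (hγ.mem s (hsub hs))).comp s (hγd s (hsub hs))
    · exact (hcont.mono hsub).intervalIntegrable
  refine Tendsto.congr' hint ?_
  have hl0 : Tendsto γ (𝓝[>] 0) (𝓝[regularLocus x] 0) :=
    tendsto_nhdsWithin_iff.2 ⟨hγ.source, hI0.mono hγ.mem⟩
  have hl1 : Tendsto γ (𝓝[<] 1) (Bornology.cobounded ℂ ⊓ 𝓟 (regularLocus x)) :=
    tendsto_inf.2 ⟨hγ.target, tendsto_principal.2 (hI1.mono hγ.mem)⟩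
  exact ((h1.comp hl1).comp tendsto_snd).sub ((h0.comp hl0).comp tendsto_fst)

section

variable {p q lam r nu : ℂ}

theorem exists_isVorosPath (h : lam ≠ 0 ∨ r ≠ 0) : ∃ γ, IsVorosPath (coverX p q lam r) γ := by
  classical
  set P : Polynomial ℂ := Polynomial.C (6 * p) * Polynomial.X ^ 4 +
    Polynomial.C (2 * q) * Polynomial.X ^ 3 + Polynomial.C lam * Polynomial.X +
    Polynomial.C (2 * r) with hP
  have hP0 : P ≠ 0 := by
    intro h0
    have c0 := congrArg (fun Q => Polynomial.coeff Q 0) h0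
    have c1 := congrArg (fun Q => Polynomial.coeff Q 1) h0
    simp [hP, Polynomial.coeff_X, Polynomial.coeff_C, Polynomial.coeff_X_pow, -map_mul] at c0 c1
    exact h.elim (· c1) (· c0)
  -- `P` is `z * hess z`, so its nonzero roots are the turning points. The path is an open ray whose
  -- slope `c` differs from the slopes of these finitely many roots.
  obtain ⟨c, hc⟩ := Infinite.exists_notMem_finset
    (P.roots.toFinset.image fun z : ℂ => z.im / z.re)
  set v : ℂ := ⟨1, c⟩ with hv
  have hv0 : v ≠ 0 := fun h0 => one_ne_zero (congrArg Complex.re h0)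
  refine ⟨fun s => ((s / (1 - s) : ℝ) : ℂ) * v, ?_, ?_, ?_, ?_⟩
  · refine ContDiffOn.mul ?_ contDiffOn_const
    refine Complex.ofRealCLM.contDiff.comp_contDiffOn ?_
    refine contDiffOn_id.div (contDiffOn_const.sub contDiffOn_id) fun s hs => ?_
    exact sub_ne_zero.2 hs.2.ne'
  · intro s hs
    have hpos : 0 < s / (1 - s) := div_pos hs.1 (sub_pos.2 hs.2)
    set k := s / (1 - s) with hk
    have hz : (k : ℂ) * v ≠ 0 := mul_ne_zero (by exact_mod_cast hpos.ne') hv0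
    refine (mem_regularLocus_coverX h).2 ⟨hz, fun hA => hc ?_⟩
    refine Finset.mem_image.2 ⟨(k : ℂ) * v, ?_, ?_⟩
    · rw [Multiset.mem_toFinset, Polynomial.mem_roots hP0, Polynomial.IsRoot.def]
      have : P.eval ((k : ℂ) * v) = (k * v) * hess p q lam r (k * v) := by
        simp only [hP, hess, Polynomial.eval_add, Polynomial.eval_mul, Polynomial.eval_C,
          Polynomial.eval_pow, Polynomial.eval_X]
        have hr : (k * v) * (2 * r / (k * v)) = 2 * r := mul_div_cancel₀ _ hz
        linear_combination -hr
      rw [this, hA, mul_zero]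
    · rw [Complex.re_ofReal_mul, Complex.im_ofReal_mul, hv]
      field_simp
  · have : ContinuousAt (fun s : ℝ => ((s / (1 - s) : ℝ) : ℂ) * v) 0 := by
      refine ContinuousAt.mul (Complex.continuous_ofReal.continuousAt.comp ?_) continuousAt_const
      exact continuousAt_id.div (continuousAt_const.sub continuousAt_id) (by simp)
    have h0 := this.tendsto
    simp only [zero_div, Complex.ofReal_zero, zero_mul] at h0
    exact h0.mono_left nhdsWithin_le_nhds
  · rw [← tendsto_norm_atTop_iff_cobounded]
    simp only [norm_mul, Complex.norm_real]
    refine Tendsto.atTop_mul_const (norm_pos_iff.2 hv0) (tendsto_norm_atTop_atTop.comp ?_)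
    have hsub : Tendsto (fun s : ℝ => 1 - s) (𝓝[<] 1) (𝓝[>] 0) := by
      refine tendsto_nhdsWithin_iff.2 ⟨?_, ?_⟩
      · have : Tendsto (fun s : ℝ => 1 - s) (𝓝 1) (𝓝 (1 - 1)) := (by fun_prop : Continuous _).tendsto 1
        rw [sub_self] at this
        exact this.mono_left nhdsWithin_le_nhds
      · filter_upwards [self_mem_nhdsWithin] with s (hs : s < 1)
        exact sub_pos.2 hs
    have hid : Tendsto (fun s : ℝ => s) (𝓝[<] 1) (𝓝 1) := tendsto_id.mono_left nhdsWithin_le_nhds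
    simp only [div_eq_mul_inv]
    exact hid.pos_mul_atTop one_pos (tendsto_inv_nhdsGT_zero.comp hsub)

/-! ### Limits of the wave function at the two endpoints -/

theorem coeffTendsto_inv_hess_mul_tail {l : Filter ℂ} {a b c : ℂ}
    (ha : Tendsto (fun z => (hess p q lam r z)⁻¹ * (p * z ^ 3)) l (𝓝 a))
    (hb : Tendsto (fun z => (hess p q lam r z)⁻¹ * lam) l (𝓝 b))
    (hc : Tendsto (fun z => (hess p q lam r z)⁻¹ * (r / z)) l (𝓝 c)) :
    CoeffTendsto (fun z => C (hess p q lam r z)⁻¹ * tail p lam r z) l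
      (C a * X ^ 3 + C b * logTail + C c * invTail) := by
  refine ((((CoeffTendsto.C ha).mul (CoeffTendsto.const (X ^ 3))).add
    ((CoeffTendsto.C hb).mul (CoeffTendsto.const logTail))).add
    ((CoeffTendsto.C hc).mul (CoeffTendsto.const invTail))).congr fun z => ?_
  simp only [tail, map_mul]
  ring

theorem coeffTendsto_psi_zero {l : Filter ℂ} {a c : ℂ}
    (hA : Tendsto (fun z => (hess p q lam r z)⁻¹) l (𝓝 0))
    (ha : Tendsto (fun z => (hess p q lam r z)⁻¹ * (p * z ^ 3)) l (𝓝 a))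
    (hc : Tendsto (fun z => (hess p q lam r z)⁻¹ * (r / z)) l (𝓝 c)) :
    CoeffTendsto (psi p q lam r nu 0) l 1 := by
  have h := coeffTendsto_saddle_of_inv_tendsto_zero hA
    (coeffTendsto_inv_hess_mul_tail ha (hA.mul_const lam) hc) (binom (nu - 1))
  rw [constantCoeff_binom, map_one] at h
  exact h.congr fun z => by simp [psi]

theorem tendsto_formalLog_psi_zero {l : Filter ℂ} (h : CoeffTendsto (psi p q lam r nu 0) l 1)
    (m : ℕ) : Tendsto (fun z => coeff m (formalLog (psi p q lam r nu 0 z))) l (𝓝 0) := by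
  simpa [formalLog_one] using h.formalLog constantCoeff_psi_zero (map_one _) m

theorem coeffTendsto_psi_zero_cobounded (h : p ≠ 0 ∨ (p = 0 ∧ q ≠ 0)) :
    CoeffTendsto (psi p q lam r nu 0) (Bornology.cobounded ℂ) 1 := by
  have hw : Tendsto (fun z : ℂ => z⁻¹) (Bornology.cobounded ℂ) (𝓝 0) := tendsto_inv₀_cobounded
  have hne : ∀ᶠ z : ℂ in Bornology.cobounded ℂ, z ≠ 0 := Bornology.eventually_ne_cobounded 0
  have key (f : ℂ → ℂ) (hf : ContinuousAt f 0) :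
      Tendsto (fun z => f z⁻¹) (Bornology.cobounded ℂ) (𝓝 (f 0)) := hf.tendsto.comp hw
  rcases h with hp | ⟨rfl, hq⟩
  · have e (z : ℂ) (hz : z ≠ 0) : hess p q lam r z =
        z ^ 3 * (6 * p + 2 * q * z⁻¹ + lam * z⁻¹ ^ 3 + 2 * r * z⁻¹ ^ 4) := by
      simp only [hess]
      field_simp
    have hc (f : ℂ → ℂ) (hf : Continuous f) : ContinuousAt
        (fun w : ℂ => f w * (6 * p + 2 * q * w + lam * w ^ 3 + 2 * r * w ^ 4)⁻¹) 0 :=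
      hf.continuousAt.mul (ContinuousAt.inv₀ (by fun_prop) (by simpa using hp))
    -- The limit `a` is read off from the dominant term `6 p z³` of `hess`.
    refine coeffTendsto_psi_zero (a := p * (6 * p)⁻¹) (c := 0) ?_ ?_ ?_
    · have := key _ (hc (fun w => w ^ 3) (by fun_prop))
      refine Tendsto.congr' ?_ (by simpa using this)
      filter_upwards [hne] with z hz
      rw [e z hz, mul_inv]
      simp only [inv_pow]
    · have := key _ (hc (fun _ => p) (by fun_prop))
      refine Tendsto.congr' ?_ (by simpa using this)
      filter_upwards [hne] with z hz
      rw [e z hz, mul_inv]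
      field_simp
    · have := key _ (hc (fun w => r * w ^ 4) (by fun_prop))
      refine Tendsto.congr' ?_ (by simpa using this)
      filter_upwards [hne] with z hz
      rw [e z hz, mul_inv, div_eq_mul_inv]
      ring
  · have e (z : ℂ) (hz : z ≠ 0) : hess 0 q lam r z =
        z ^ 2 * (2 * q + lam * z⁻¹ ^ 2 + 2 * r * z⁻¹ ^ 3) := by
      simp only [hess]
      field_simp
      ring
    have hc (f : ℂ → ℂ) (hf : Continuous f) : ContinuousAt
        (fun w : ℂ => f w * (2 * q + lam * w ^ 2 + 2 * r * w ^ 3)⁻¹) 0 :=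
      hf.continuousAt.mul (ContinuousAt.inv₀ (by fun_prop) (by simpa using hq))
    refine coeffTendsto_psi_zero (a := 0) (c := 0) ?_ ?_ ?_
    · have := key _ (hc (fun w => w ^ 2) (by fun_prop))
      refine Tendsto.congr' ?_ (by simpa using this)
      filter_upwards [hne] with z hz
      rw [e z hz, mul_inv]
      simp only [inv_pow]
    · simp
    · have := key _ (hc (fun w => r * w ^ 3) (by fun_prop))
      refine Tendsto.congr' ?_ (by simpa using this)
      filter_upwards [hne] with z hz
      rw [e z hz, mul_inv, div_eq_mul_inv]
      ring

theorem coeffTendsto_psi_zero_nhdsNE (hr : r ≠ 0) :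
    CoeffTendsto (psi p q lam r nu 0) (𝓝[≠] 0) 1 := by
  have key (f : ℂ → ℂ) (hf : ContinuousAt f 0) : Tendsto f (𝓝[≠] 0) (𝓝 (f 0)) :=
    hf.tendsto.mono_left nhdsWithin_le_nhds
  have e (z : ℂ) (hz : z ≠ 0) : hess p q lam r z =
      z⁻¹ * (6 * p * z ^ 4 + 2 * q * z ^ 3 + lam * z + 2 * r) := by
    simp only [hess]
    field_simp
  have hc (f : ℂ → ℂ) (hf : Continuous f) : ContinuousAt
      (fun z : ℂ => f z * (6 * p * z ^ 4 + 2 * q * z ^ 3 + lam * z + 2 * r)⁻¹) 0 :=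
    hf.continuousAt.mul (ContinuousAt.inv₀ (by fun_prop) (by simpa using hr))
  -- Near `0` the term `2 r / z` dominates `hess`, which gives the limit `c`.
  refine coeffTendsto_psi_zero (a := 0) (c := r * (2 * r)⁻¹) ?_ ?_ ?_
  · have := key _ (hc (fun z => z) (by fun_prop))
    refine Tendsto.congr' ?_ (by simpa using this)
    filter_upwards [self_mem_nhdsWithin] with z hz
    rw [e z hz, mul_inv, inv_inv]
  · have := key _ (hc (fun z => z * (p * z ^ 3)) (by fun_prop))
    refine Tendsto.congr' ?_ (by simpa using this)
    filter_upwards [self_mem_nhdsWithin] with z hz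
    rw [e z hz, mul_inv, inv_inv]
    ring
  · have := key _ (hc (fun _ => r) (by fun_prop))
    refine Tendsto.congr' ?_ (by simpa using this)
    filter_upwards [self_mem_nhdsWithin] with z (hz : z ≠ 0)
    rw [e z hz, mul_inv, inv_inv]
    field_simp

theorem coeffTendsto_psi_gammaSaddle (hlam : lam ≠ 0) :
    CoeffTendsto (psi p q lam 0 nu 0) (𝓝[≠] 0) (gammaSaddle lam nu) := by
  have key (f : ℂ → ℂ) (hf : ContinuousAt f 0) : Tendsto f (𝓝[≠] 0) (𝓝 (f 0)) :=
    hf.tendsto.mono_left nhdsWithin_le_nhds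
  have e : hess p q lam 0 = fun z => 6 * p * z ^ 3 + 2 * q * z ^ 2 + lam := by
    funext z
    simp [hess]
  have hA : Tendsto (hess p q lam 0) (𝓝[≠] 0) (𝓝 lam) := by
    simpa [e] using key (hess p q lam 0) (by rw [e]; fun_prop)
  have hAi := hA.inv₀ hlam
  have h3 : Tendsto (fun z : ℂ => p * z ^ 3) (𝓝[≠] 0) (𝓝 (p * 0 ^ 3)) := key _ (by fun_prop)
  rw [show p * (0 : ℂ) ^ 3 = 0 by simp] at h3
  have h := coeffTendsto_inv_hess_mul_tail (hAi.mul h3) (hAi.mul_const lam)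
    (c := 0) (by simp)
  rw [show C (lam⁻¹ * 0) * X ^ 3 + C (lam⁻¹ * lam) * logTail + C 0 * invTail =
    C lam⁻¹ * (C lam * logTail) by simp [mul_assoc]] at h
  exact (coeffTendsto_saddle hA hlam h (binom (nu - 1))).congr fun z => by simp [psi]

/-- The primitive `formalLog (psi 0)` tends to `0` at infinity and to `formalLog G` at `0`, whence
the minus sign in `hV`. Condition `hP'` gives uniqueness, so the conclusion covers every WKB
solution. -/
theorem isVorosCoefficient_coverX {P : Fin 4 → ℂ → ℂ⟦X⟧} {V : ℂ⟦X⟧} {G : ℂ⟦X⟧}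
    (h : lam ≠ 0 ∨ r ≠ 0) (hpq : p ≠ 0 ∨ (p = 0 ∧ q ≠ 0))
    (hP : ∀ z ∈ regularLocus (coverX p q lam r),
      P 0 (coverX p q lam r z) * psi p q lam r nu 3 z + P 1 (coverX p q lam r z) *
        psi p q lam r nu 2 z + P 2 (coverX p q lam r z) * psi p q lam r nu 1 z +
        P 3 (coverX p q lam r z) * psi p q lam r nu 0 z = 0)
    (hP' : ∀ z ∈ regularLocus (coverX p q lam r),
      3 * constantCoeff (P 0 (coverX p q lam r z)) * z ^ 2 +
      2 * constantCoeff (P 1 (coverX p q lam r z)) * z +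
      constantCoeff (P 2 (coverX p q lam r z)) ≠ 0)
    (hG : CoeffTendsto (psi p q lam r nu 0) (𝓝[≠] 0) G) (hG1 : constantCoeff G = 1)
    (hV0 : coeff 0 V = 0) (hV : ∀ m : ℕ, coeff (m + 1) V = -coeff (m + 1) (formalLog G)) :
    IsVorosCoefficient P (coverX p q lam r) (fun z => z) V := by
  have hU := isOpen_regularLocus_coverX (p := p) (q := q) h
  refine ⟨⟨_, isWKB_ratio h hP⟩, exists_isVorosPath h, fun σ γ hσ hγ => ⟨hV0, fun m hm => ?_⟩⟩
  have hF : ∀ z ∈ regularLocus (coverX p q lam r),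
      HasDerivAt (fun w => coeff m (formalLog (psi p q lam r nu 0 w)))
        (coeff (m + 1) (σ z) * deriv (coverX p q lam r) z) z := fun z hz => by
    rw [hσ.eq_of_isWKB hU hP' (isWKB_ratio h hP) hz]
    exact hasDerivAt_coeff_formalLog_psi h hz hm
  have hsub : regularLocus (coverX p q lam r) ⊆ {0}ᶜ := fun z hz =>
    ((mem_regularLocus_coverX h).1 hz).1
  have h0 := (hG.formalLog constantCoeff_psi_zero hG1 m).mono_left (nhdsWithin_mono 0 hsub)
  have h1 := (tendsto_formalLog_psi_zero (coeffTendsto_psi_zero_cobounded (lam := lam) (r := r)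
    (nu := nu) hpq) m).mono_left (inf_le_left (b := 𝓟 (regularLocus (coverX p q lam r))))
  obtain ⟨m, rfl⟩ : ∃ k, m = k + 1 := ⟨m - 1, by lia⟩
  rw [HasPathIntegral, hV m, ← zero_sub]
  exact tendsto_integral_of_hasDerivAt
    (g := fun z => coeff (m + 1 + 1) (σ z) * deriv (coverX p q lam r) z) hU hγ hF h0 h1

end

/-! ### Specialization to the two curves -/

theorem x14_eq_coverX (t lam : ℂ) : x14 t lam = coverX 1 t lam 0 := by
  funext z
  simp [x14, coverX]

theorem x23_eq_coverX (t lam : ℂ) : x23 t lam = coverX 0 (-1) lam (-t / 2) := by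
  funext z
  simp only [x23, coverX]
  ring

theorem C_ofNat_three : (C 3 : ℂ⟦X⟧) = 3 := rfl

theorem C_ofNat_two : (C 2 : ℂ⟦X⟧) = 2 := rfl

theorem psi_equation14 (t lam nu : ℂ) {z : ℂ} (hz : z ≠ 0) (hA : hess 1 t lam 0 z ≠ 0) :
    3 * psi 1 t lam 0 nu 3 z + 2 * C t * psi 1 t lam 0 nu 2 z +
      C (coverX 1 t lam 0 z) * psi 1 t lam 0 nu 1 z - lambdaHat lam nu * psi 1 t lam 0 nu 0 z
      = 0 := by
  have h := saddle_recurrence hz hA (nu - 1)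
  simp only [psi, lambdaHat, Nat.cast_ofNat, Nat.cast_one, Nat.cast_zero, add_zero, pow_zero,
    pow_one, map_one, one_mul, sub_add_cancel]
  simp only [zero_div, map_zero, zero_mul, sub_zero, sub_add_cancel, mul_one] at h
  simp only [map_mul, C_ofNat_three, C_ofNat_two] at h
  linear_combination h

/-- The term `r/ξ` makes the recurrence reach down to exponent `s - 1`, so `s = ν` is taken here
rather than `ν - 1`. The recurrence is multiplied by `-2 z`, and its `s + 1 = ν + 1` accounts for
`λ̂ - ħ`. -/
theorem psi_equation23 (t lam nu : ℂ) {z : ℂ} (hz : z ≠ 0)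
    (hA : hess 0 (-1) lam (-t / 2) z ≠ 0) :
    4 * psi 0 (-1) lam (-t / 2) nu 3 z -
      2 * C (coverX 0 (-1) lam (-t / 2) z) * psi 0 (-1) lam (-t / 2) nu 2 z +
      2 * (lambdaHat lam nu - X) * psi 0 (-1) lam (-t / 2) nu 1 z -
      C t * psi 0 (-1) lam (-t / 2) nu 0 z = 0 := by
  have h := saddle_recurrence hz hA nu
  have e1 : nu - 1 + (3 : ℕ) = nu + 2 := by push_cast; ring
  have e2 : nu - 1 + (2 : ℕ) = nu + 1 := by push_cast; ring
  have e3 : nu - 1 + (1 : ℕ) = nu := by push_cast; ring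
  have e4 : nu - 1 + (0 : ℕ) = nu - 1 := by push_cast; ring
  simp only [psi, lambdaHat, e1, e2, e3, e4, pow_zero, pow_one, map_one, one_mul]
  have c1 : C z * C (2 * -1 * z ^ 2) = -2 * (C (z ^ 3) : ℂ⟦X⟧) := by
    rw [← C_ofNat_two, ← map_neg, ← map_mul, ← map_mul]
    congr 1
    ring
  have c2 : C z * C (z * coverX 0 (-1) lam (-t / 2) z) =
      C (z ^ 2) * (C (coverX 0 (-1) lam (-t / 2) z) : ℂ⟦X⟧) := by
    rw [← map_mul, ← map_mul]
    congr 1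
    ring
  have c3 : 2 * (C z * C (-t / 2 / z)) = (-C t : ℂ⟦X⟧) := by
    rw [← C_ofNat_two, ← map_neg, ← map_mul, ← map_mul]
    congr 1
    field_simp
  have c4 : (C (nu + 1) : ℂ⟦X⟧) = C nu + 1 := by rw [map_add, map_one]
  simp only [mul_zero, zero_mul, map_zero, zero_add, c4] at h
  linear_combination (-2 * C z) * h
    + 2 * saddle (hess 0 (-1) lam (-t / 2) z) (tail 0 lam (-t / 2) z) (binom (nu + 2)) * c1
    + 2 * saddle (hess 0 (-1) lam (-t / 2) z) (tail 0 lam (-t / 2) z) (binom (nu + 1)) * c2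
    - saddle (hess 0 (-1) lam (-t / 2) z) (tail 0 lam (-t / 2) z) (binom (nu - 1)) * c3

theorem isVorosCoefficient_quantumCurve14 {lam : ℂ} (t nu : ℂ) (hlam : lam ≠ 0) :
    IsVorosCoefficient (quantumCurve14 t lam nu) (x14 t lam) (fun z => z)
      (PowerSeries.mk fun m : ℕ =>
        if m = 0 then 0
        else Polynomial.aeval nu (Polynomial.bernoulli (m + 1)) / ((m : ℂ) * ((m : ℂ) + 1))
          * (1 / lam) ^ m) := by
  rw [x14_eq_coverX]
  refine isVorosCoefficient_coverX (nu := nu) (G := gammaSaddle lam nu) (Or.inl hlam)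
    (Or.inl one_ne_zero) (fun z hz => ?_) (fun z hz => ?_) (coeffTendsto_psi_gammaSaddle hlam)
    (constantCoeff_gammaSaddle lam nu) (by simp) fun m => ?_
  · obtain ⟨hz0, hA⟩ := (mem_regularLocus_coverX (Or.inl hlam)).1 hz
    simp only [quantumCurve14, Matrix.cons_val]
    linear_combination psi_equation14 t lam nu hz0 hA
  · obtain ⟨hz0, hA⟩ := (mem_regularLocus_coverX (Or.inl hlam)).1 hz
    -- The `y`-derivative of the classical curve equals `hess / z`, so it is nonzero off the turning
    -- points.
    have e : z * (9 * z ^ 2 + 4 * t * z + coverX 1 t lam 0 z) = z * (hess 1 t lam 0 z / z) := by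
      simp only [coverX, hess]
      field_simp
      ring
    have e' := mul_left_cancel₀ hz0 e
    intro h0
    refine div_ne_zero hA hz0 (e'.symm.trans ?_)
    refine Eq.trans ?_ h0
    simp only [quantumCurve14, Matrix.cons_val, map_mul, constantCoeff_C, map_ofNat]
    ring
  · rw [coeff_formalLog_gammaSaddle hlam, coeff_mk, if_neg m.succ_ne_zero, neg_neg]
    push_cast
    ring

theorem isVorosCoefficient_quantumCurve23 {t : ℂ} (lam nu : ℂ) (ht : t ≠ 0) :
    IsVorosCoefficient (quantumCurve23 t lam nu) (x23 t lam) (fun z => z) 0 := by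
  have hr : -t / 2 ≠ 0 := div_ne_zero (neg_ne_zero.2 ht) two_ne_zero
  rw [x23_eq_coverX]
  refine isVorosCoefficient_coverX (nu := nu) (G := 1) (Or.inr hr)
    (Or.inr ⟨rfl, neg_ne_zero.2 one_ne_zero⟩) (fun z hz => ?_) (fun z hz => ?_)
    (coeffTendsto_psi_zero_nhdsNE hr) (map_one _) (by simp) fun m => by simp [formalLog_one]
  · obtain ⟨hz0, hA⟩ := (mem_regularLocus_coverX (Or.inr hr)).1 hz
    simp only [quantumCurve23, Matrix.cons_val]
    linear_combination psi_equation23 t lam nu hz0 hA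
  · obtain ⟨hz0, hA⟩ := (mem_regularLocus_coverX (Or.inr hr)).1 hz
    have e : 12 * z ^ 2 - 4 * coverX 0 (-1) lam (-t / 2) z * z + 2 * lam =
        -2 * hess 0 (-1) lam (-t / 2) z := by
      simp only [coverX, hess]
      field_simp
      ring
    intro h0
    refine mul_ne_zero (by norm_num) hA (e.symm.trans ?_)
    refine Eq.trans ?_ h0
    simp only [quantumCurve23, lambdaHat, Matrix.cons_val, map_mul, map_sub, map_neg,
      constantCoeff_C, constantCoeff_X, map_ofNat]
    ring

end VorosWKB

theorem mainTheorem3 :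
    (∀ t lam nu : ℂ, lam ≠ 0 →
      VorosWKB.IsVorosCoefficient (VorosWKB.quantumCurve14 t lam nu) (VorosWKB.x14 t lam)
        (fun z => z)
        (PowerSeries.mk fun m : ℕ =>
          if m = 0 then 0
          else Polynomial.aeval nu (Polynomial.bernoulli (m + 1)) / ((m : ℂ) * ((m : ℂ) + 1))
            * (1 / lam) ^ m)) ∧
    (∀ t lam nu : ℂ, t ≠ 0 →
      VorosWKB.IsVorosCoefficient (VorosWKB.quantumCurve23 t lam nu) (VorosWKB.x23 t lam)
        (fun z => z) 0) := by
  exact ⟨fun t _ nu hlam => VorosWKB.isVorosCoefficient_quantumCurve14 t nu hlam,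
    fun _ lam nu ht => VorosWKB.isVorosCoefficient_quantumCurve23 lam nu ht⟩
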